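/- Let $(M,g)$ be a smooth Riemannian manifold of dimension $n$ (Hausdorff, second countable, without boundary), with Levi-Civita connection $\nabla$, Riemannian volume measure $\mathrm{Vol}_M$ and Christoffel symbols $\Gamma_{ij}^l=\frac12 g^{lm}(\partial_i g_{jm}+\partial_j g_{im}-\partial_m g_{ij})$ in a chart. (Repeated indices are summed.) On covariant tensors let $\nabla_a T_{i_1\dots i_\ell}=\partial_aT_{i_1\dots i_\ell}-\sum_{\mu=1}^{\ell}\Gamma_{a i_\mu}^lT_{i_1\dots i_{\mu-1}\,l\,i_{\mu+1}\dots i_\ell}$, and let $\nabla^*$ be the formal adjoint, $(\nabla^*\theta)_{i_1\dots i_\ell}=-g^{ab}\nabla_a\theta_{i_1\dots i_\ell b}$, acting on smooth covariant $(\ell+1)$-tensor fields $\theta$; let $g(S,T)=g^{i_1j_1}\cdots g^{i_\ell j_\ell}S_{i_1\dots i_\ell}T_{j_1\dots j_\ell}$. A function $u\in L^1_{loc}(M)$ has a weak $\nabla^\ell$ derivative ($\ell\ge1$) if there is an $L^1_{loc}$ covariant $\ell$-tensor field $\tau$ (written $\nabla^\ell u$) with $$\int_M g(\tau,\theta)\,\mathrm{Vol}_M=\int_M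 u\,(\nabla^*)^\ell\theta\,\mathrm{Vol}_M$$ for every smooth compactly supported covariant $\ell$-tensor field $\theta$. For an open $D\subseteq\mathbb R^n$ and $f\in L^1_{loc}(D)$, a function $v\in L^1_{loc}(D)$ is the Euclidean weak partial derivative $\partial_{j_1}\cdots\partial_{j_\ell}f$ on $D$ if $\int_D v\psi\,dx=(-1)^\ell\int_D f\,\partial_{j_1}\cdots\partial_{j_\ell}\psi\,dx$ for all $\psi\in C_c^\infty(D)$. **Theorem.** Let $k\ge1$, let $(\phi,\Omega)$ be a smooth chart on $M$, and suppose that $u:M\to\mathbb R$ has a weak $\nabla^\ell$ derivative on $M$ for every $1\le\ell\le k$. Then: 1. for every $1\le\ell\le k$ and all indices $j_1,\dots,j_\ell$, the function $u\circ\phi^{-1}$ has a Euclidean weak partial derivative $\partial_{j_1}\cdots\partial_{j_\ell}(u\circ\phi^{-1})$ on $\phi(\Omega)$; 2. if $\tau^{(0)}=u$ and $\tau^{(\ell)}$ is a weak $\nabla^\ell$ derivative of $u$ for $1\le\ell\le k$, then for all $1\le\ell\le k$ and all indices $i_1,\dots,i_\ell$, the component $\tau^{(\ell-1)}_{i_1\dots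 i_{\ell-1}}\circ\phi^{-1}$ has a Euclidean weak partial derivative $\partial_{i_\ell}$ on $\phi(\Omega)$, and almost everywhere on $\phi(\Omega)$, in the coordinates of $\phi$, $$\tau^{(\ell)}_{i_1\dots i_\ell}=\partial_{i_\ell}\tau^{(\ell-1)}_{i_1\dots i_{\ell-1}}-\sum_{\mu=1}^{\ell-1}\Gamma_{i_\ell i_\mu}^{l}\,\tau^{(\ell-1)}_{i_1\dots i_{\mu-1}\,l\,i_{\mu+1}\dots i_{\ell-1}},$$ where $\partial_{i_\ell}$ is the Euclidean weak partial derivative. -/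

import Mathlib

open MeasureTheory Set
open scoped Manifold ContDiff

noncomputable section

namespace WeakCov

/-- The model space `ℝⁿ`. -/
abbrev Eu (n : ℕ) : Type := EuclideanSpace ℝ (Fin n)

/-- The standard basis vectors of `ℝⁿ`. -/
abbrev stdVec {n : ℕ} (i : Fin n) : Eu n := EuclideanSpace.single i (1 : ℝ)

/-- The classical partial derivative `∂_i f`. -/
def partialD {n : ℕ} (i : Fin n) (f : Eu n → ℝ) (y : Eu n) : ℝ :=
  fderiv ℝ f y (stdVec i)

/-- The classical iterated partial derivative `∂_{I 0} ⋯ ∂_{I (k-1)} f`. -/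
def iterPartialD {n k : ℕ} (I : Fin k → Fin n) (f : Eu n → ℝ) (y : Eu n) : ℝ :=
  iteratedFDeriv ℝ k f y (fun j => stdVec (I j))

/-- On the open set `D ⊆ ℝⁿ`, the locally integrable function `v` is the Euclidean weak partial
derivative `∂_{I 0} ⋯ ∂_{I (k-1)} f` of the locally integrable function `f`. -/
def IsWeakPartial {n k : ℕ} (D : Set (Eu n)) (f : Eu n → ℝ) (I : Fin k → Fin n)
    (v : Eu n → ℝ) : Prop :=
  LocallyIntegrableOn f D ∧ LocallyIntegrableOn v D ∧
    ∀ ψ : Eu n → ℝ, ContDiff ℝ ∞ ψ → HasCompactSupport ψ → tsupport ψ ⊆ D →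
      ∫ y in D, v y * ψ y = (-1) ^ k * ∫ y in D, f y * iterPartialD I ψ y

variable {n : ℕ} {M : Type*} [TopologicalSpace M] [ChartedSpace (Eu n) M]

/-- Smooth charts of `M` (the smooth maximal atlas). -/
abbrev smoothCharts (n : ℕ) (M : Type*) [TopologicalSpace M] [ChartedSpace (Eu n) M] :
    Set (OpenPartialHomeomorph M (Eu n)) :=
  IsManifold.maximalAtlas (𝓡 n) ∞ M

/-- A (not necessarily continuous) covariant `k`-tensor field on `M`. -/
abbrev TensorField (n : ℕ) (M : Type*) [TopologicalSpace M] [ChartedSpace (Eu n) M]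
    (k : ℕ) : Type _ :=
  ∀ x : M, MultilinearMap ℝ (fun _ : Fin k => TangentSpace (𝓡 n) x) ℝ

/-- A function, seen as a covariant `0`-tensor field. -/
def scalarField (u : M → ℝ) : TensorField n M 0 :=
  fun x => MultilinearMap.constOfIsEmpty ℝ (fun _ : Fin 0 => TangentSpace (𝓡 n) x) (u x)

/-- The coordinate vector field `∂_i` of the chart `e`, at the point with coordinates `y`. -/
def coordVec (e : OpenPartialHomeomorph M (Eu n)) (i : Fin n) (y : Eu n) :
    TangentSpace (𝓡 n) (e.symm y) :=
  mfderiv (𝓡 n) (𝓡 n) e.symm y (stdVec i)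

/-- The coordinate covector `dx^i` of the chart `e`, at the point `x`. -/
def coordCovec (e : OpenPartialHomeomorph M (Eu n)) (i : Fin n) (x : M) :
    TangentSpace (𝓡 n) x →ₗ[ℝ] ℝ :=
  (EuclideanSpace.proj i : Eu n →L[ℝ] ℝ).toLinearMap ∘ₗ
    (mfderiv (𝓡 n) (𝓡 n) e x : TangentSpace (𝓡 n) x →L[ℝ] Eu n).toLinearMap

/-- The component `T_{I 0 … I (k-1)}` of `T` in the chart `e`, as a function of the
coordinates `y`. -/
def comp (e : OpenPartialHomeomorph M (Eu n)) {k : ℕ} (T : TensorField n M k)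
    (I : Fin k → Fin n) (y : Eu n) : ℝ :=
  T (e.symm y) (fun j => coordVec e (I j) y)

/-- The tensor `∑ c_I dx^{I 0} ⊗ ⋯ ⊗ dx^{I (k-1)}` at `x`. -/
def ofComp (e : OpenPartialHomeomorph M (Eu n)) {k : ℕ} (x : M) (c : (Fin k → Fin n) → ℝ) :
    MultilinearMap ℝ (fun _ : Fin k => TangentSpace (𝓡 n) x) ℝ :=
  ∑ I : Fin k → Fin n, c I •
    (MultilinearMap.mkPiAlgebra ℝ (Fin k) ℝ).compLinearMap (fun j => coordCovec e (I j) x)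

/-- The tensor field is smooth: its components are smooth in every smooth chart. -/
def IsSmoothTensor {k : ℕ} (T : TensorField n M k) : Prop :=
  ∀ e ∈ smoothCharts n M, ∀ I : Fin k → Fin n, ContDiffOn ℝ ∞ (comp e T I) e.target

/-- The tensor field vanishes outside a compact set. -/
def IsCompactlySupported {k : ℕ} (T : TensorField n M k) : Prop :=
  ∃ K : Set M, IsCompact K ∧ ∀ x, x ∉ K → T x = 0

/-- The tensor field is of class `L¹_loc`: its components are locally integrable in every
smooth chart. -/
def IsLocL1Tensor {k : ℕ} (T : TensorField n M k) : Prop :=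
  ∀ e ∈ smoothCharts n M, ∀ I : Fin k → Fin n, LocallyIntegrableOn (comp e T I) e.target

variable [IsManifold (𝓡 n) ∞ M]

/-- Smooth Riemannian metrics on `M`. -/
abbrev RiemMetric (n : ℕ) (M : Type*) [TopologicalSpace M] [ChartedSpace (Eu n) M]
    [IsManifold (𝓡 n) ∞ M] : Type _ :=
  Bundle.ContMDiffRiemannianMetric (𝓡 n) ∞ (Eu n) (fun x : M => TangentSpace (𝓡 n) x)

/-- The matrix `(g_{ij})` of the metric in the chart `e`. -/
def gMat (g : RiemMetric n M) (e : OpenPartialHomeomorph M (Eu n)) (y : Eu n) :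
    Matrix (Fin n) (Fin n) ℝ :=
  Matrix.of fun i j => g.inner (e.symm y) (coordVec e i y) (coordVec e j y)

/-- The inverse matrix `(g^{ij})`. -/
def gInv (g : RiemMetric n M) (e : OpenPartialHomeomorph M (Eu n)) (y : Eu n) :
    Matrix (Fin n) (Fin n) ℝ :=
  (gMat g e y)⁻¹

/-- The Christoffel symbol
`Γ_{ij}^l = ½ g^{lm} (∂_i g_{jm} + ∂_j g_{im} - ∂_m g_{ij})` of the chart `e`. -/
def christoffel (g : RiemMetric n M) (e : OpenPartialHomeomorph M (Eu n)) (i j l : Fin n)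
    (y : Eu n) : ℝ :=
  (1 / 2 : ℝ) * ∑ m, gInv g e y l m *
    (partialD i (fun z => gMat g e z j m) y + partialD j (fun z => gMat g e z i m) y
      - partialD m (fun z => gMat g e z i j) y)

/-- The Christoffel terms `∑_μ Γ_{a, I μ}^l T_{I 0 … l … I (k-1)}` (with `l` in slot `μ`, summed
over `l`). -/
def christoffelSum (g : RiemMetric n M) (e : OpenPartialHomeomorph M (Eu n)) {k : ℕ}
    (T : TensorField n M k) (a : Fin n) (I : Fin k → Fin n) (y : Eu n) : ℝ :=
  ∑ μ : Fin k, ∑ l : Fin n,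
    christoffel g e a (I μ) l y * comp e T (Function.update I μ l) y

/-- The component `∇_a T_{I 0 … I (k-1)}`, for the Levi-Civita connection, of the covariant
derivative of a differentiable tensor field in the chart `e`. -/
def covComp (g : RiemMetric n M) (e : OpenPartialHomeomorph M (Eu n)) {k : ℕ}
    (T : TensorField n M k) (a : Fin n) (I : Fin k → Fin n) (y : Eu n) : ℝ :=
  partialD a (comp e T I) y - christoffelSum g e T a I y

/-- The formal adjoint `∇*` of `∇` on covariant tensors:
`(∇*θ)_{I} = - g^{ab} ∇_a θ_{I b}`. The derivative index of `∇T` is its last slot, so that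
it is the last slot of `θ` that is contracted. The right-hand side is a tensor,
i.e. independent of the chart; it is evaluated in the preferred chart at `x`. -/
def covAdjoint (g : RiemMetric n M) {k : ℕ} (θ : TensorField n M (k + 1)) : TensorField n M k :=
  fun x =>
    let e := chartAt (Eu n) x
    ofComp e x fun I =>
      -∑ a, ∑ b, gInv g e (e x) a b *
        covComp g e θ a (Fin.snoc (α := fun _ => Fin n) I b) (e x)

/-- The function `(∇*)^k θ`, for a `k`-tensor field `θ`. -/
def covAdjointPow (g : RiemMetric n M) : (k : ℕ) → TensorField n M k → M → ℝ
  | 0, θ => fun x => θ x Fin.elim0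
  | k + 1, θ => covAdjointPow g k (covAdjoint g θ)

/-- The inner product `g(S,T) = g^{i_1 j_1} ⋯ g^{i_k j_k} S_{i_1 … i_k} T_{j_1 … j_k}` of
tensors. It is independent of the chart and evaluated in the preferred chart at `x`. -/
def tensorInner (g : RiemMetric n M) {k : ℕ} (S T : TensorField n M k) (x : M) : ℝ :=
  let e := chartAt (Eu n) x
  ∑ I : Fin k → Fin n, ∑ J : Fin k → Fin n,
    (∏ m, gInv g e (e x) (I m) (J m)) * comp e S I (e x) * comp e T J (e x)

variable [MeasurableSpace M]

/-- The measure `√(det g) dx¹ ⋯ dxⁿ` on the domain of the chart `e`, as a measure on `M` that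
vanishes outside that domain. -/
def chartVol (g : RiemMetric n M) (e : OpenPartialHomeomorph M (Eu n)) : Measure M :=
  ((volume.restrict e.target).withDensity
    (fun y => ENNReal.ofReal (Real.sqrt (gMat g e y).det))).map e.symm

/-- The Riemannian volume measure: the measure that equals `√(det g) dx¹ ⋯ dxⁿ` on the domain of
every smooth chart. As these local measures agree on overlaps, it is their supremum in the lattice
of measures. -/
def vol (g : RiemMetric n M) : Measure M :=
  ⨆ e : smoothCharts n M, chartVol g (e : OpenPartialHomeomorph M (Eu n))

/-- The `L¹_loc` tensor field `τ` is the weak `∇^k` derivative of the `L¹_loc` function `u`. -/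
def IsWeakCovDeriv (g : RiemMetric n M) {k : ℕ} (u : M → ℝ) (τ : TensorField n M k) : Prop :=
  LocallyIntegrable u (vol g) ∧ IsLocL1Tensor τ ∧
    ∀ θ : TensorField n M k, IsSmoothTensor θ → IsCompactlySupported θ →
      ∫ x, tensorInner g τ θ x ∂(vol g) = ∫ x, u x * covAdjointPow g k θ x ∂(vol g)

end WeakCov

end

/-! Raising indices turns tests against tensors into tests against functions. In the chart `e`, put
ρ = √det g and take θ = (ψ/ρ) g(∂_{i_1},·) ⊗ ⋯ ⊗ g(∂_{i_k},·) ⊗ g(∂_a,·), extended by zero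
(`dualField`). Pairing τ with θ gives (ψ/ρ) τ_{i_1…i_k a} (`tensorInner_dualField`), and ρ cancels
against the volume density, so the integral of g(τ,θ) is ∫ τ_{i_1…i_k a} ψ dx.

The field ∇*θ is again a combination of such fields (`covAdjoint_dualField`). Since ∇g = 0, the
derivative falls only on ψ/ρ and on the coordinate vectors. Since ρ⁻¹∂_a is divergence free, that
is, ∂_a log ρ = Γ_{ia}^i (`hasFDerivAt_density`), the derivative of 1/ρ cancels the Christoffel term
of the contracted slot. What remains is -∂_aψ/ρ on the indices i_1…i_k, and -(ψ/ρ) Γ_{a i_μ}^l on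
the indices with i_μ replaced by l.

Hence ∇*θ is an admissible test field for τ^{(k)}. Testing τ^{(k+1)} with θ and τ^{(k)} with ∇*θ
both give ∫ u (∇*)^{k+1}θ; equating the two in coordinates is the weak form of claim 2
(`IsWeakCovDeriv.isWeakPartial_comp`). Claim 1 follows by induction and the Leibniz rule
(`hasWeakPartials_comp`): the derivative of a component is a component of the next order plus smooth
multiples of components of the same order.

The adjoint and the inner product are evaluated at x in the preferred chart at x, so the
computations are carried out in an arbitrary second chart `e'`. This requires the transformation law
of the Christoffel symbols (`chrVec_transform`) and the basis independence of contractions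
(`IsInner.sum_inv_gram_mul`). The volume, a supremum over charts, is identified on one chart domain
in `vol_restrict`. -/

noncomputable section

namespace WeakCov

/-! ### Charts, their derivatives, and the metric as a bilinear form in coordinates -/

section Charts

variable {n : ℕ} {M : Type*} [TopologicalSpace M] [ChartedSpace (Eu n) M]

/-- The derivative of the inverse of a chart, as an endomorphism of the model space. -/
def dSymm (e : OpenPartialHomeomorph M (Eu n)) (y : Eu n) : Eu n →L[ℝ] Eu n :=
  mfderiv (𝓡 n) (𝓡 n) e.symm y

/-- The derivative of a chart, as an endomorphism of the model space. -/
def dChart (e : OpenPartialHomeomorph M (Eu n)) (x : M) : Eu n →L[ℝ] Eu n :=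
  mfderiv (𝓡 n) (𝓡 n) e x

/-- The change of coordinates from the chart `e'` to the chart `e`. -/
def transition (e e' : OpenPartialHomeomorph M (Eu n)) (y : Eu n) : Eu n := e (e'.symm y)

theorem mdifferentiable_of_mem_smoothCharts {e : OpenPartialHomeomorph M (Eu n)}
    (he : e ∈ smoothCharts n M) : e.MDifferentiable (𝓡 n) (𝓡 n) :=
  ⟨(contMDiffOn_of_mem_maximalAtlas he).mdifferentiableOn (by simp),
    (contMDiffOn_symm_of_mem_maximalAtlas he).mdifferentiableOn (by simp)⟩

/-- Tangent spaces are copies of the model space, so derivatives are treated as endomorphisms of ℝⁿ;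
this keeps base points out of the types in later rewriting. -/
theorem dSymm_dChart {e : OpenPartialHomeomorph M (Eu n)} (he : e ∈ smoothCharts n M) {x : M}
    (hx : x ∈ e.source) (v : Eu n) : dSymm e (e x) (dChart e x v) = v := by
  have := (mdifferentiable_of_mem_smoothCharts he).symm_comp_deriv hx
  exact congrArg (fun L : Eu n →L[ℝ] Eu n => L v) this

theorem dChart_dSymm {e : OpenPartialHomeomorph M (Eu n)} (he : e ∈ smoothCharts n M) {x : M}
    (hx : x ∈ e.source) (v : Eu n) : dChart e x (dSymm e (e x) v) = v := by
  have := (mdifferentiable_of_mem_smoothCharts he).comp_symm_deriv (e.map_source hx)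
  rw [e.left_inv hx] at this
  exact congrArg (fun L : Eu n →L[ℝ] Eu n => L v) this

theorem contMDiffAt_chart {e : OpenPartialHomeomorph M (Eu n)} (he : e ∈ smoothCharts n M) {x : M}
    (hx : x ∈ e.source) : ContMDiffAt (𝓡 n) (𝓡 n) ∞ e x :=
  (contMDiffOn_of_mem_maximalAtlas he).contMDiffAt (e.open_source.mem_nhds hx)

theorem contMDiffAt_chart_symm {e : OpenPartialHomeomorph M (Eu n)} (he : e ∈ smoothCharts n M)
    {y : Eu n} (hy : y ∈ e.target) : ContMDiffAt (𝓡 n) (𝓡 n) ∞ e.symm y :=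
  (contMDiffOn_symm_of_mem_maximalAtlas he).contMDiffAt (e.open_target.mem_nhds hy)

theorem contDiffAt_transition {e e' : OpenPartialHomeomorph M (Eu n)} (he : e ∈ smoothCharts n M)
    (he' : e' ∈ smoothCharts n M) {y : Eu n} (hy : y ∈ e'.target) (hy' : e'.symm y ∈ e.source) :
    ContDiffAt ℝ ∞ (transition e e') y :=
  contMDiffAt_iff_contDiffAt.1 <|
    (contMDiffAt_chart he hy').comp y (contMDiffAt_chart_symm he' hy)

theorem fderiv_transition {e e' : OpenPartialHomeomorph M (Eu n)} (he : e ∈ smoothCharts n M)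
    (he' : e' ∈ smoothCharts n M) {y : Eu n} (hy : y ∈ e'.target) (hy' : e'.symm y ∈ e.source)
    (v : Eu n) : fderiv ℝ (transition e e') y v = dChart e (e'.symm y) (dSymm e' y v) := by
  have h1 := (contMDiffAt_chart he hy').mdifferentiableAt (by simp)
  have h2 := (contMDiffAt_chart_symm he' hy).mdifferentiableAt (by simp)
  have h3 := mfderiv_comp y h1 h2
  rw [mfderiv_eq_fderiv] at h3
  exact congrArg (fun L : Eu n →L[ℝ] Eu n => L v) h3

theorem dSymm_fderiv_transition {e e' : OpenPartialHomeomorph M (Eu n)}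
    (he : e ∈ smoothCharts n M) (he' : e' ∈ smoothCharts n M) {y : Eu n} (hy : y ∈ e'.target)
    (hy' : e'.symm y ∈ e.source) (v : Eu n) :
    dSymm e (transition e e' y) (fderiv ℝ (transition e e') y v) = dSymm e' y v := by
  rw [fderiv_transition he he' hy hy', transition, dSymm_dChart he hy']

variable [IsManifold (𝓡 n) ∞ M]

/-- The scalar product of a Riemannian metric, on the model space. -/
def innerE (g : RiemMetric n M) (x : M) : Eu n →L[ℝ] Eu n →L[ℝ] ℝ := g.inner x

/-- The bilinear form of a Riemannian metric in the coordinates of the chart `e`. -/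
def metForm (g : RiemMetric n M) (e : OpenPartialHomeomorph M (Eu n)) (y : Eu n) :
    Eu n →L[ℝ] Eu n →L[ℝ] ℝ :=
  (innerE g (e.symm y)).bilinearComp (dSymm e y) (dSymm e y)

theorem gMat_apply (g : RiemMetric n M) (e : OpenPartialHomeomorph M (Eu n)) (y : Eu n)
    (i j : Fin n) : gMat g e y i j = metForm g e y (stdVec i) (stdVec j) := rfl

theorem metForm_apply (g : RiemMetric n M) (e : OpenPartialHomeomorph M (Eu n)) (y v w : Eu n) :
    metForm g e y v w = innerE g (e.symm y) (dSymm e y v) (dSymm e y w) := rfl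

theorem metForm_symm (g : RiemMetric n M) (e : OpenPartialHomeomorph M (Eu n)) (y v w : Eu n) :
    metForm g e y v w = metForm g e y w v := g.symm _ _ _

theorem metForm_transition (g : RiemMetric n M) {e e' : OpenPartialHomeomorph M (Eu n)}
    (he : e ∈ smoothCharts n M) (he' : e' ∈ smoothCharts n M) {y : Eu n} (hy : y ∈ e'.target)
    (hy' : e'.symm y ∈ e.source) (v w : Eu n) :
    metForm g e' y v w = metForm g e (transition e e' y) (fderiv ℝ (transition e e') y v)
      (fderiv ℝ (transition e e') y w) := by
  rw [metForm_apply, metForm_apply, dSymm_fderiv_transition he he' hy hy',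
    dSymm_fderiv_transition he he' hy hy', transition, e.left_inv hy']

theorem metForm_pos (g : RiemMetric n M) {e : OpenPartialHomeomorph M (Eu n)}
    (he : e ∈ smoothCharts n M) {y : Eu n} (hy : y ∈ e.target) {v : Eu n} (hv : v ≠ 0) :
    0 < metForm g e y v v := by
  refine g.pos (e.symm y) (dSymm e y v) fun h => hv ?_
  have h1 := dChart_dSymm he (e.map_target hy) v
  rw [e.right_inv hy] at h1
  rw [← h1]
  exact (congrArg (dChart e (e.symm y)) h).trans (map_zero _)

/-- The coordinate vector fields are smooth sections, being the tangent map of `e.symm` applied to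
constant fields. The metric is a smooth section too, and evaluating it on them gives smooth
functions. -/
theorem contDiffOn_metForm (g : RiemMetric n M) {e : OpenPartialHomeomorph M (Eu n)}
    (he : e ∈ smoothCharts n M) : ContDiffOn ℝ ∞ (metForm g e) e.target := by
  have hs := contMDiffOn_symm_of_mem_maximalAtlas he
  have hsec (v : Eu n) : ContMDiffOn (𝓡 n) ((𝓡 n).prod 𝓘(ℝ, Eu n)) ∞
      (fun y => (⟨e.symm y, mfderiv (𝓡 n) (𝓡 n) e.symm y v⟩ : TangentBundle (𝓡 n) M))
      e.target := by
    have h1 := hs.contMDiffOn_tangentMapWithin (m := ∞) (by simp) e.open_target.uniqueMDiffOn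
    have h2 : ContMDiffOn (𝓡 n) ((𝓡 n).prod 𝓘(ℝ, Eu n)) ∞
        (fun y => (⟨y, v⟩ : TangentBundle (𝓡 n) (Eu n))) e.target :=
      contMDiffOn_vectorSpace_iff_contDiffOn.2 contDiffOn_const
    refine (h1.comp h2 (fun y hy => hy)).congr fun y hy => ?_
    simp only [tangentMapWithin, Function.comp]
    rw [mfderivWithin_of_isOpen e.open_target hy]
  rw [contDiffOn_clm_apply]
  intro v
  rw [contDiffOn_clm_apply]
  intro w
  rw [← contMDiffOn_iff_contDiffOn]
  have h3 := (g.contMDiff.contMDiffOn (s := univ)).comp hs (fun _ _ => mem_univ _)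
  have h4 := ContMDiffOn.clm_bundle_apply₂ (F₁ := Eu n) (F₂ := Eu n) (F₃ := ℝ)
    (E₁ := fun x : M => TangentSpace (𝓡 n) x) (E₂ := fun x : M => TangentSpace (𝓡 n) x)
    (E₃ := fun _ : M => ℝ) (b := e.symm) h3 (hsec v) (hsec w)
  intro y hy
  have h5 := h4 y hy
  rw [Bundle.contMDiffWithinAt_totalSpace] at h5
  exact h5.2

end Charts

/-! ### Linear algebra of scalar products: Gram matrices and contractions -/

section BilinearForms

variable {n : ℕ}

/-- The matrix of a bilinear form on the model space. -/
def gram (b : Eu n →L[ℝ] Eu n →L[ℝ] ℝ) : Matrix (Fin n) (Fin n) ℝ :=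
  Matrix.of fun i j => b (stdVec i) (stdVec j)

theorem sum_stdVec (v : Eu n) : ∑ i, v i • stdVec i = v := by
  ext j
  simp [Finset.sum_apply, Pi.single_apply]

/-- A symmetric positive definite bilinear form. -/
structure IsInner (b : Eu n →L[ℝ] Eu n →L[ℝ] ℝ) : Prop where
  symm : ∀ v w, b v w = b w v
  pos : ∀ v, v ≠ 0 → 0 < b v v

/-- The Gram matrix of a basis is positive definite. -/
theorem IsInner.posDef_of_linearIndependent {b : Eu n →L[ℝ] Eu n →L[ℝ] ℝ} (hb : IsInner b)
    {f : Fin n → Eu n} (hf : LinearIndependent ℝ f) :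
    (Matrix.of fun i j => b (f i) (f j)).PosDef := by
  refine Matrix.PosDef.of_dotProduct_mulVec_pos ?_ fun x hx => ?_
  · ext i j
    simp [Matrix.conjTranspose_apply, hb.symm (f j) (f i)]
  · have h : ∑ i, x i • f i ≠ 0 := fun h =>
      hx (funext fun i => Fintype.linearIndependent_iff.1 hf x h i)
    refine (hb.pos _ h).trans_eq ?_
    simp only [map_sum, map_smul, sum_apply, smul_apply, smul_eq_mul, Finset.mul_sum, dotProduct,
      Matrix.mulVec, Matrix.of_apply, star_trivial]
    refine Finset.sum_congr rfl fun i _ => Finset.sum_congr rfl fun j _ => ?_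
    rw [hb.symm (f j)]
    ring

theorem linearIndependent_stdVec : LinearIndependent ℝ (stdVec : Fin n → Eu n) := by
  rw [Fintype.linearIndependent_iff]
  intro c hc i
  have := congrArg (fun v : Eu n => v i) hc
  simpa [Finset.sum_apply, Pi.single_apply] using this

theorem IsInner.gram_posDef {b : Eu n →L[ℝ] Eu n →L[ℝ] ℝ} (hb : IsInner b) :
    (gram b).PosDef :=
  hb.posDef_of_linearIndependent linearIndependent_stdVec

theorem IsInner.eq_of_forall {b : Eu n →L[ℝ] Eu n →L[ℝ] ℝ} (hb : IsInner b) {v w : Eu n}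
    (h : ∀ x, b v x = b w x) : v = w := by
  by_contra hvw
  have h1 := hb.pos (v - w) (sub_ne_zero.2 hvw)
  have h2 : b (v - w) (v - w) = b v (v - w) - b w (v - w) := by rw [map_sub b, sub_apply]
  rw [h2, h, sub_self] at h1
  exact h1.false

/-- Every vector is recovered from its scalar products with a basis. -/
theorem IsInner.sum_inv_gram_smul {b : Eu n →L[ℝ] Eu n →L[ℝ] ℝ} (hb : IsInner b)
    {f : Fin n → Eu n} (hf : LinearIndependent ℝ f) (w : Eu n) :
    ∑ i, ∑ j, ((Matrix.of fun i j => b (f i) (f j))⁻¹ i j * b (f j) w) • f i = w := by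
  set G : Matrix (Fin n) (Fin n) ℝ := Matrix.of fun i j => b (f i) (f j) with hG
  have hdet : IsUnit G.det := (hb.posDef_of_linearIndependent hf).det_pos.ne'.isUnit
  let B := basisOfLinearIndependentOfCardEqFinrank' f hf (by simp)
  have hB (i) : B i = f i := by simp [B]
  obtain ⟨c, rfl⟩ : ∃ c : Fin n → ℝ, ∑ i, c i • f i = w :=
    ⟨B.repr w, by simpa [hB] using B.sum_repr w⟩
  refine Finset.sum_congr rfl fun i _ => ?_
  rw [← Finset.sum_smul]
  congr 1
  have h1 : G⁻¹.mulVec (G.mulVec c) i = c i := by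
    rw [Matrix.mulVec_mulVec, Matrix.nonsing_inv_mul _ hdet, Matrix.one_mulVec]
  rw [← h1]
  simp [Matrix.mulVec, dotProduct, hG, map_sum, mul_comm]

/-- The contraction of a bilinear form by a scalar product does not depend on the basis. -/
theorem IsInner.sum_inv_gram_mul {b : Eu n →L[ℝ] Eu n →L[ℝ] ℝ} (hb : IsInner b)
    {f f' : Fin n → Eu n} (hf : LinearIndependent ℝ f) (hf' : LinearIndependent ℝ f')
    (T : Eu n →ₗ[ℝ] Eu n →ₗ[ℝ] ℝ) :
    ∑ i, ∑ j, (Matrix.of fun i j => b (f i) (f j))⁻¹ i j * T (f i) (f j) =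
      ∑ i, ∑ j, (Matrix.of fun i j => b (f' i) (f' j))⁻¹ i j * T (f' i) (f' j) := by
  set G : Matrix (Fin n) (Fin n) ℝ := Matrix.of fun i j => b (f i) (f j) with hG
  set G' : Matrix (Fin n) (Fin n) ℝ := Matrix.of fun i j => b (f' i) (f' j) with hG'
  have hsymm (k l) : G'⁻¹ k l = G'⁻¹ l k := by
    have h := (hb.posDef_of_linearIndependent hf').isHermitian.inv
    simpa using (h.apply k l).symm
  -- Expand the second argument in the basis `f'`, exchange the sums, and recognise the expansion of
  -- `f' l` in the basis `f`.
  calc ∑ i, ∑ j, G⁻¹ i j * T (f i) (f j)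
      = ∑ i, ∑ j, G⁻¹ i j * T (f i) (∑ k, ∑ l, (G'⁻¹ k l * b (f' l) (f j)) • f' k) := by
        simp only [hG', hb.sum_inv_gram_smul hf']
    _ = ∑ i, ∑ j, ∑ k, ∑ l, G'⁻¹ k l * (G⁻¹ i j * b (f j) (f' l) * T (f i) (f' k)) := by
        simp only [map_sum, map_smul, Finset.mul_sum, smul_eq_mul]
        refine Finset.sum_congr rfl fun i _ => Finset.sum_congr rfl fun j _ =>
          Finset.sum_congr rfl fun k _ => Finset.sum_congr rfl fun l _ => ?_
        rw [hb.symm (f j)]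
        ring
    _ = ∑ k, ∑ l, G'⁻¹ k l * T (∑ i, ∑ j, (G⁻¹ i j * b (f j) (f' l)) • f i) (f' k) := by
        simp only [map_sum, map_smul, Finset.mul_sum, smul_eq_mul, LinearMap.sum_apply,
          LinearMap.smul_apply]
        calc _ = ∑ i, ∑ k, ∑ j, ∑ l, G'⁻¹ k l * (G⁻¹ i j * b (f j) (f' l) * T (f i) (f' k)) :=
              Finset.sum_congr rfl fun i _ => Finset.sum_comm
          _ = ∑ k, ∑ i, ∑ j, ∑ l, G'⁻¹ k l * (G⁻¹ i j * b (f j) (f' l) * T (f i) (f' k)) :=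
              Finset.sum_comm
          _ = ∑ k, ∑ i, ∑ l, ∑ j, G'⁻¹ k l * (G⁻¹ i j * b (f j) (f' l) * T (f i) (f' k)) :=
              Finset.sum_congr rfl fun k _ => Finset.sum_congr rfl fun i _ => Finset.sum_comm
          _ = _ := Finset.sum_congr rfl fun k _ => Finset.sum_comm
    _ = ∑ k, ∑ l, G'⁻¹ l k * T (f' l) (f' k) := by
        simp only [hG, hb.sum_inv_gram_smul hf]
        exact Finset.sum_congr rfl fun k _ => Finset.sum_congr rfl fun l _ => by rw [hsymm k l]
    _ = _ := Finset.sum_comm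

end BilinearForms

/-! ### Christoffel symbols, the Levi-Civita connection and the volume density -/

section Koszul

variable {n : ℕ}

/-- The Christoffel symbols of the first kind, as a trilinear form. -/
def koszul (B : Eu n → Eu n →L[ℝ] Eu n →L[ℝ] ℝ) (y u v w : Eu n) : ℝ :=
  (1 / 2 : ℝ) * (fderiv ℝ B y u v w + fderiv ℝ B y v u w - fderiv ℝ B y w u v)

/-- The Christoffel symbols of the second kind, as a vector-valued bilinear map. -/
def chrVec (B : Eu n → Eu n →L[ℝ] Eu n →L[ℝ] ℝ) (y u v : Eu n) : Eu n :=
  ∑ l, (∑ m, (gram (B y))⁻¹ l m * koszul B y u v (stdVec m)) • stdVec l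

variable {B : Eu n → Eu n →L[ℝ] Eu n →L[ℝ] ℝ} {y : Eu n}

theorem fderiv_apply_apply (hB : DifferentiableAt ℝ B y) (u v w : Eu n) :
    fderiv ℝ (fun z => B z v w) y u = fderiv ℝ B y u v w := by
  have h := (hB.hasFDerivAt.clm_apply (hasFDerivAt_const v y)).clm_apply (hasFDerivAt_const w y)
  rw [h.fderiv]
  simp

theorem fderiv_symm (hB : DifferentiableAt ℝ B y) (hs : ∀ z v w, B z v w = B z w v)
    (u v w : Eu n) : fderiv ℝ B y u v w = fderiv ℝ B y u w v := by
  rw [← fderiv_apply_apply hB, ← fderiv_apply_apply hB]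
  simp only [hs _ v w]

/-- The Gram matrix cancels its inverse. This characterises the Christoffel vector by its scalar
products, so later identities need no inverse matrix. -/
theorem inner_chrVec (hb : IsInner (B y)) (u v w : Eu n) :
    B y (chrVec B y u v) w = koszul B y u v w := by
  have h1 : ∑ l, ∑ m, ((gram (B y))⁻¹ l m * koszul B y u v (stdVec m)) • stdVec l =
      chrVec B y u v := by
    simp only [chrVec, Finset.sum_smul]
  have hdet : IsUnit (gram (B y)).det := hb.gram_posDef.det_pos.ne'.isUnit
  have h2 (k : Fin n) : B y (chrVec B y u v) (stdVec k) = koszul B y u v (stdVec k) := by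
    rw [hb.symm]
    have h3 : (gram (B y)).mulVec ((gram (B y))⁻¹.mulVec fun m => koszul B y u v (stdVec m)) k =
        koszul B y u v (stdVec k) := by
      rw [Matrix.mulVec_mulVec, Matrix.mul_nonsing_inv _ hdet, Matrix.one_mulVec]
    rw [← h3, chrVec]
    simp [Matrix.mulVec, dotProduct, gram, map_sum, mul_comm]
  conv_lhs => rw [← sum_stdVec w]
  conv_rhs => rw [← sum_stdVec w]
  simp only [map_sum, map_smul, h2, koszul, sum_apply, smul_eq_mul,
    smul_apply]
  rw [← Finset.sum_add_distrib, ← Finset.sum_sub_distrib, Finset.mul_sum]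
  exact Finset.sum_congr rfl fun i _ => by ring

/-- The Levi-Civita connection is compatible with the metric. -/
theorem fderiv_eq_inner_chrVec (hB : DifferentiableAt ℝ B y) (hs : ∀ z v w, B z v w = B z w v)
    (hb : IsInner (B y)) (u v w : Eu n) :
    fderiv ℝ B y u v w = B y (chrVec B y u v) w + B y v (chrVec B y u w) := by
  rw [hb.symm v, inner_chrVec hb, inner_chrVec hb, koszul, koszul, fderiv_symm hB hs u w v,
    fderiv_symm hB hs v u w, fderiv_symm hB hs w u v]
  ring

/-- The transformation rule of the Christoffel symbols under a change of coordinates. -/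
theorem chrVec_transform {B' : Eu n → Eu n →L[ℝ] Eu n →L[ℝ] ℝ} {φ : Eu n → Eu n}
    (hφ : ContDiffAt ℝ ∞ φ y) (hφs : Function.Surjective (fderiv ℝ φ y))
    (hB : DifferentiableAt ℝ B (φ y)) (hB' : DifferentiableAt ℝ B' y)
    (hs : ∀ z v w, B z v w = B z w v) (hb : IsInner (B (φ y))) (hb' : IsInner (B' y))
    (h : ∀ᶠ z in nhds y, ∀ v w, B' z v w = B (φ z) (fderiv ℝ φ z v) (fderiv ℝ φ z w))
    (u v : Eu n) :
    fderiv ℝ φ y (chrVec B' y u v) =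
      chrVec B (φ y) (fderiv ℝ φ y u) (fderiv ℝ φ y v) + fderiv ℝ (fderiv ℝ φ) y u v := by
  have hφ1 : HasFDerivAt φ (fderiv ℝ φ y) y := (hφ.differentiableAt (by simp)).hasFDerivAt
  have hφ2 : HasFDerivAt (fderiv ℝ φ) (fderiv ℝ (fderiv ℝ φ) y) y :=
    ((hφ.fderiv_right (m := ∞) (by simp)).differentiableAt (by simp)).hasFDerivAt
  have hsymm (a c : Eu n) : fderiv ℝ (fderiv ℝ φ) y a c = fderiv ℝ (fderiv ℝ φ) y c a :=
    (hφ.isSymmSndFDerivAt (by simp; exact WithTop.coe_le_coe.2 le_top)).eq a c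
  -- Differentiating the pulled back form yields second derivatives of φ; in the Koszul combination,
  -- by symmetry of the Hessian, only the term in D²φ(u, v) survives.
  have hd (a c d : Eu n) : fderiv ℝ B' y a c d =
      fderiv ℝ B (φ y) (fderiv ℝ φ y a) (fderiv ℝ φ y c) (fderiv ℝ φ y d) +
      B (φ y) (fderiv ℝ (fderiv ℝ φ) y a c) (fderiv ℝ φ y d) +
      B (φ y) (fderiv ℝ φ y c) (fderiv ℝ (fderiv ℝ φ) y a d) := by
    rw [← fderiv_apply_apply hB']
    have h1 : (fun z => B' z c d) =ᶠ[nhds y]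
        fun z => B (φ z) (fderiv ℝ φ z c) (fderiv ℝ φ z d) := h.mono fun z hz => hz c d
    have h2 : HasFDerivAt (fun z => B (φ z)) ((fderiv ℝ B (φ y)).comp (fderiv ℝ φ y)) y :=
      HasFDerivAt.comp (g := B) y hB.hasFDerivAt hφ1
    have h3 (c : Eu n) : HasFDerivAt (fun z => fderiv ℝ φ z c)
        ((fderiv ℝ (fderiv ℝ φ) y).flip c) y := by
      simpa using hφ2.clm_apply (hasFDerivAt_const c y)
    rw [h1.fderiv_eq, ((h2.clm_apply (h3 c)).clm_apply (h3 d)).fderiv]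
    simp
    ring
  refine hb.eq_of_forall fun w => ?_
  -- Every test vector is an image under Dφ, so pairing with it is pairing in the form `B'`.
  obtain ⟨c, rfl⟩ := hφs w
  rw [← h.self_of_nhds, inner_chrVec hb', map_add, add_apply, inner_chrVec hb,
    koszul, koszul, hd, hd, hd, hsymm v u, hsymm c u, hsymm c v,
    hs _ (fderiv ℝ φ y v) (fderiv ℝ (fderiv ℝ φ) y u c)]
  ring

/-- The derivative of a covector paired with a pulled back constant vector field. -/
theorem hasFDerivAt_inner_fderiv {φ : Eu n → Eu n} (hφ : ContDiffAt ℝ ∞ φ y)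
    (hB : DifferentiableAt ℝ B (φ y)) (X v : Eu n) :
    ∃ L : Eu n →L[ℝ] ℝ, HasFDerivAt (fun z => B (φ z) X (fderiv ℝ φ z v)) L y ∧
      ∀ u, L u = fderiv ℝ B (φ y) (fderiv ℝ φ y u) X (fderiv ℝ φ y v) +
        B (φ y) X (fderiv ℝ (fderiv ℝ φ) y u v) := by
  have hφ1 : HasFDerivAt φ (fderiv ℝ φ y) y := (hφ.differentiableAt (by simp)).hasFDerivAt
  have hφ2 : HasFDerivAt (fderiv ℝ φ) (fderiv ℝ (fderiv ℝ φ) y) y :=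
    ((hφ.fderiv_right (m := ∞) (by simp)).differentiableAt (by simp)).hasFDerivAt
  have h2 : HasFDerivAt (fun z => B (φ z)) ((fderiv ℝ B (φ y)).comp (fderiv ℝ φ y)) y :=
    HasFDerivAt.comp (g := B) y hB.hasFDerivAt hφ1
  have h3 : HasFDerivAt (fun z => fderiv ℝ φ z v) ((fderiv ℝ (fderiv ℝ φ) y).flip v) y := by
    simpa using hφ2.clm_apply (hasFDerivAt_const v y)
  refine ⟨_, (h2.clm_apply (hasFDerivAt_const X y)).clm_apply h3, fun u => ?_⟩
  simp
  ring

/-- The covariant derivative of the covector field dual to a constant vector field, in other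
coordinates. -/
theorem fderiv_inner_sub_chrVec {B' : Eu n → Eu n →L[ℝ] Eu n →L[ℝ] ℝ} {φ : Eu n → Eu n}
    (hφ : ContDiffAt ℝ ∞ φ y) (hφs : Function.Surjective (fderiv ℝ φ y))
    (hB : DifferentiableAt ℝ B (φ y)) (hB' : DifferentiableAt ℝ B' y)
    (hs : ∀ z v w, B z v w = B z w v) (hb : IsInner (B (φ y))) (hb' : IsInner (B' y))
    (h : ∀ᶠ z in nhds y, ∀ v w, B' z v w = B (φ z) (fderiv ℝ φ z v) (fderiv ℝ φ z w))
    (X u v : Eu n) :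
    fderiv ℝ (fun z => B (φ z) X (fderiv ℝ φ z v)) y u -
        B (φ y) X (fderiv ℝ φ y (chrVec B' y u v)) =
      B (φ y) (chrVec B (φ y) (fderiv ℝ φ y u) X) (fderiv ℝ φ y v) := by
  obtain ⟨L, hL, hLu⟩ := hasFDerivAt_inner_fderiv hφ hB X v
  -- The Hessian of φ cancels against the inhomogeneous term of the transformation rule; metric
  -- compatibility does the rest.
  rw [hL.fderiv, hLu, chrVec_transform hφ hφs hB hB' hs hb hb' h, fderiv_eq_inner_chrVec hB hs hb,
    map_add]
  ring

/-- Jacobi's formula. -/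
theorem hasFDerivAt_det {E : Type*} [NormedAddCommGroup E] [NormedSpace ℝ E]
    {A : E → Matrix (Fin n) (Fin n) ℝ} {A' : Fin n → Fin n → E →L[ℝ] ℝ} {x : E}
    (h : ∀ i j, HasFDerivAt (fun z => A z i j) (A' i j) x) :
    HasFDerivAt (fun z => (A z).det) (∑ i, ∑ k, (A x).adjugate i k • A' k i) x := by
  have h1 : HasFDerivAt (fun z => (A z).det) (∑ σ : Equiv.Perm (Fin n),
      ((Equiv.Perm.sign σ : ℤ) : ℝ) •
        ∑ i, (∏ j ∈ Finset.univ.erase i, A x (σ j) j) • A' (σ i) i) x := by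
    simp only [Matrix.det_apply']
    refine HasFDerivAt.fun_sum fun σ _ => HasFDerivAt.const_mul ?_ _
    exact HasFDerivAt.finsetProd fun i _ => h (σ i) i
  convert h1 using 1
  ext v
  simp only [sum_apply, smul_apply, smul_eq_mul, Finset.mul_sum]
  rw [Finset.sum_comm (s := (Finset.univ : Finset (Equiv.Perm (Fin n))))]
  refine Finset.sum_congr rfl fun i _ => ?_
  -- By Cramer's rule, each column contributes the determinant with that column replaced by its
  -- derivative.
  have h2 : ∑ k, (A x).adjugate i k * A' k i v =
      ((A x).updateCol i fun k => A' k i v).det := by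
    rw [← Matrix.cramer_apply, Matrix.cramer_eq_adjugate_mulVec]
    rfl
  rw [h2, Matrix.det_apply']
  refine Finset.sum_congr rfl fun σ _ => ?_
  rw [← Finset.mul_prod_erase _ _ (Finset.mem_univ i), Matrix.updateCol_self, mul_comm (A' _ _ _)]
  congr 2
  exact Finset.prod_congr rfl fun j hj => Matrix.updateCol_ne (Finset.ne_of_mem_erase hj)

/-- The Riemannian volume density. -/
def density (B : Eu n → Eu n →L[ℝ] Eu n →L[ℝ] ℝ) (y : Eu n) : ℝ :=
  Real.sqrt (gram (B y)).det

theorem density_pos (hb : IsInner (B y)) : 0 < density B y :=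
  Real.sqrt_pos.2 hb.gram_posDef.det_pos

/-- The logarithmic derivative of the volume density is the trace of the Christoffel symbols. -/
theorem hasFDerivAt_density (hB : DifferentiableAt ℝ B y) (hs : ∀ z v w, B z v w = B z w v)
    (hb : IsInner (B y)) :
    ∃ L : Eu n →L[ℝ] ℝ, HasFDerivAt (density B) L y ∧ ∀ a, L a = density B y *
      ∑ i, ∑ j, (gram (B y))⁻¹ i j * B y (chrVec B y (stdVec i) a) (stdVec j) := by
  have h0 (i j : Fin n) : DifferentiableAt ℝ (fun z => gram (B z) i j) y :=
    (hB.clm_apply (differentiableAt_const _)).clm_apply (differentiableAt_const _)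
  have hdet := hb.gram_posDef.det_pos
  have h1 := (hasFDerivAt_det fun i j => (h0 i j).hasFDerivAt).sqrt hdet.ne'
  refine ⟨_, h1, fun a => ?_⟩
  have hinv (i j) : (gram (B y))⁻¹ i j = (gram (B y)).det⁻¹ * (gram (B y)).adjugate i j := by
    rw [Matrix.inv_def, Ring.inverse_eq_inv']
    rfl
  have hsymm (k l) : (gram (B y))⁻¹ k l = (gram (B y))⁻¹ l k := by
    simpa using (hb.gram_posDef.isHermitian.inv.apply k l).symm
  have h2 : ∑ i, ∑ j, (gram (B y))⁻¹ i j * B y (chrVec B y (stdVec i) a) (stdVec j) =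
      (1 / 2 : ℝ) * ∑ i, ∑ j, (gram (B y))⁻¹ i j * fderiv ℝ B y a (stdVec j) (stdVec i) := by
    -- The first and third Koszul terms cancel when contracted with the symmetric inverse matrix,
    -- leaving half the trace of the derivative of the metric.
    have h3 : ∑ i, ∑ j, (gram (B y))⁻¹ i j * fderiv ℝ B y (stdVec i) a (stdVec j) =
        ∑ i, ∑ j, (gram (B y))⁻¹ i j * fderiv ℝ B y (stdVec j) (stdVec i) a := by
      rw [Finset.sum_comm]
      refine Finset.sum_congr rfl fun i _ => Finset.sum_congr rfl fun j _ => ?_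
      rw [hsymm, fderiv_symm hB hs]
    simp only [inner_chrVec hb, koszul, mul_add, mul_sub, mul_left_comm _ (1 / 2 : ℝ),
      Finset.sum_add_distrib, Finset.sum_sub_distrib, ← Finset.mul_sum, h3]
    simp only [fderiv_symm hB hs a]
    ring
  have h4 (i j : Fin n) : fderiv ℝ (fun z => gram (B z) i j) y a =
      fderiv ℝ B y a (stdVec i) (stdVec j) := fderiv_apply_apply hB _ _ _
  have h5 : density B y * density B y = (gram (B y)).det := Real.mul_self_sqrt hdet.le
  have h6 : density B y ≠ 0 := (density_pos hb).ne'
  rw [h2]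
  simp only [smul_apply, sum_apply, smul_eq_mul, h4, hinv, mul_assoc, ← Finset.mul_sum]
  rw [← h5, Real.sqrt_mul_self (density_pos hb).le]
  field_simp

end Koszul

/-! ### Changes of coordinates: neighbourhoods, supports and invertibility -/

section Transitions

variable {n : ℕ} {M : Type*} [TopologicalSpace M] {y : Eu n}

theorem transition_mem_target {e e' : OpenPartialHomeomorph M (Eu n)}
    (hy' : e'.symm y ∈ e.source) : transition e e' y ∈ e.target := e.map_source hy'

theorem eventually_mem_source {e e' : OpenPartialHomeomorph M (Eu n)} (hy : y ∈ e'.target)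
    (hy' : e'.symm y ∈ e.source) :
    ∀ᶠ z in nhds y, z ∈ e'.target ∧ e'.symm z ∈ e.source :=
  (e'.open_target.eventually_mem hy).and <|
    (e'.symm.continuousAt hy).eventually_mem (e.open_source.mem_nhds hy')

theorem isCompact_symm_image_tsupport {e : OpenPartialHomeomorph M (Eu n)} {c : Eu n → ℝ}
    (hc : HasCompactSupport c) (hct : tsupport c ⊆ e.target) :
    IsCompact (e.symm '' tsupport c) :=
  IsCompact.image_of_continuousOn hc (e.continuousOn_symm.mono hct)

variable [ChartedSpace (Eu n) M]

theorem surjective_fderiv_transition {e e' : OpenPartialHomeomorph M (Eu n)}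
    (he : e ∈ smoothCharts n M) (he' : e' ∈ smoothCharts n M) (hy : y ∈ e'.target)
    (hy' : e'.symm y ∈ e.source) :
    Function.Surjective (fderiv ℝ (transition e e') y) := fun w => by
  refine ⟨dChart e' (e'.symm y) (dSymm e (transition e e' y) w), ?_⟩
  rw [fderiv_transition he he' hy hy']
  have h := dSymm_dChart he' (e'.map_target hy) (dSymm e (transition e e' y) w)
  rw [e'.right_inv hy] at h
  rw [h]
  exact dChart_dSymm he hy' w

theorem linearIndependent_fderiv_transition {e e' : OpenPartialHomeomorph M (Eu n)}
    (he : e ∈ smoothCharts n M) (he' : e' ∈ smoothCharts n M) (hy : y ∈ e'.target)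
    (hy' : e'.symm y ∈ e.source) :
    LinearIndependent ℝ fun i => fderiv ℝ (transition e e') y (stdVec i) :=
  linearIndependent_stdVec.map' (fderiv ℝ (transition e e') y).toLinearMap
    (LinearMap.ker_eq_bot.2 <| LinearMap.injective_iff_surjective.2 <|
      surjective_fderiv_transition he he' hy hy')

end Transitions

/-! ### Contractions with the inverse metric in a second chart -/

section ChristoffelVectors

variable {n : ℕ} {B : Eu n → Eu n →L[ℝ] Eu n →L[ℝ] ℝ} {y : Eu n}

/-- The Christoffel symbols of the second kind as a linear map of the direction of
differentiation. -/
def chrLin (hb : IsInner (B y)) (v : Eu n) : Eu n →ₗ[ℝ] Eu n where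
  toFun u := chrVec B y u v
  -- Linearity is tested after pairing with `w`, where it is that of the Koszul expression.
  map_add' u u' := hb.eq_of_forall fun w => by
    simp only [map_add, add_apply, inner_chrVec hb, koszul]
    ring
  map_smul' c u := hb.eq_of_forall fun w => by
    simp only [map_smul, smul_apply, inner_chrVec hb, koszul, smul_eq_mul, RingHom.id_apply]
    ring

theorem chrLin_apply (hb : IsInner (B y)) (u v : Eu n) : chrLin hb v u = chrVec B y u v := rfl

variable {M : Type*} [TopologicalSpace M] [ChartedSpace (Eu n) M] [IsManifold (𝓡 n) ∞ M]

theorem isInner_metForm (g : RiemMetric n M) {e : OpenPartialHomeomorph M (Eu n)}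
    (he : e ∈ smoothCharts n M) (hy : y ∈ e.target) : IsInner (metForm g e y) :=
  ⟨metForm_symm g e y, fun _ => metForm_pos g he hy⟩

theorem differentiableAt_metForm (g : RiemMetric n M) {e : OpenPartialHomeomorph M (Eu n)}
    (he : e ∈ smoothCharts n M) (hy : y ∈ e.target) : DifferentiableAt ℝ (metForm g e) y :=
  ((contDiffOn_metForm g he).contDiffAt (e.open_target.mem_nhds hy)).differentiableAt (by simp)

theorem chrVec_metForm (g : RiemMetric n M) {e : OpenPartialHomeomorph M (Eu n)}
    (he : e ∈ smoothCharts n M) (hy : y ∈ e.target) (i j : Fin n) :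
    chrVec (metForm g e) y (stdVec i) (stdVec j) = ∑ l, christoffel g e i j l y • stdVec l := by
  have h (a b c : Fin n) : partialD a (fun z => gMat g e z b c) y =
      fderiv ℝ (metForm g e) y (stdVec a) (stdVec b) (stdVec c) :=
    fderiv_apply_apply (differentiableAt_metForm g he hy) _ _ _
  refine Finset.sum_congr rfl fun l _ => ?_
  congr 1
  rw [christoffel, Finset.mul_sum]
  refine Finset.sum_congr rfl fun m _ => ?_
  rw [h, h, h, koszul]
  change gInv g e y l m * _ = _
  ring

/-- Turns contractions in `e'` into contractions over another basis in the coordinates of `e`, where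
the scalar product lemmas apply. -/
theorem gInv_eq_gram_transition (g : RiemMetric n M) {e e' : OpenPartialHomeomorph M (Eu n)}
    (he : e ∈ smoothCharts n M) (he' : e' ∈ smoothCharts n M) (hy : y ∈ e'.target)
    (hy' : e'.symm y ∈ e.source) :
    gInv g e' y = (Matrix.of fun i j => metForm g e (transition e e' y)
      (fderiv ℝ (transition e e') y (stdVec i)) (fderiv ℝ (transition e e') y (stdVec j)))⁻¹ := by
  rw [gInv]
  congr 1
  ext i j
  rw [gMat_apply, metForm_transition g he he' hy hy', Matrix.of_apply]

/-- Contraction of a one-form with a covector dual to `X`. -/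
theorem sum_gInv_mul_inner (g : RiemMetric n M) {e e' : OpenPartialHomeomorph M (Eu n)}
    (he : e ∈ smoothCharts n M) (he' : e' ∈ smoothCharts n M) (hy : y ∈ e'.target)
    (hy' : e'.symm y ∈ e.source) (L : Eu n →ₗ[ℝ] ℝ) (X : Eu n) :
    ∑ a, ∑ b, gInv g e' y a b * (L (fderiv ℝ (transition e e') y (stdVec a)) *
      metForm g e (transition e e' y) X (fderiv ℝ (transition e e') y (stdVec b))) = L X := by
  have hb := isInner_metForm g he (transition_mem_target hy')
  conv_rhs =>
    rw [← hb.sum_inv_gram_smul (linearIndependent_fderiv_transition he he' hy hy') X]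
  simp only [map_sum, map_smul, smul_eq_mul, gInv_eq_gram_transition g he he' hy hy', hb.symm X]
  exact Finset.sum_congr rfl fun i _ => Finset.sum_congr rfl fun j _ => by ring

/-- The trace of the Christoffel symbols in another chart. -/
theorem sum_gInv_mul_chrVec (g : RiemMetric n M) {e e' : OpenPartialHomeomorph M (Eu n)}
    (he : e ∈ smoothCharts n M) (he' : e' ∈ smoothCharts n M) (hy : y ∈ e'.target)
    (hy' : e'.symm y ∈ e.source) (X : Eu n) :
    ∑ a, ∑ b, gInv g e' y a b * metForm g e (transition e e' y)
      (chrVec (metForm g e) (transition e e' y) (fderiv ℝ (transition e e') y (stdVec a)) X)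
      (fderiv ℝ (transition e e') y (stdVec b)) =
    ∑ i, ∑ j, (gram (metForm g e (transition e e' y)))⁻¹ i j * metForm g e (transition e e' y)
      (chrVec (metForm g e) (transition e e' y) (stdVec i) X) (stdVec j) := by
  have hb := isInner_metForm g he (transition_mem_target hy')
  rw [gInv_eq_gram_transition g he he' hy hy']
  exact hb.sum_inv_gram_mul (linearIndependent_fderiv_transition he he' hy hy')
    linearIndependent_stdVec (LinearMap.mk₂ ℝ
      (fun u w => metForm g e (transition e e' y) (chrLin hb X u) w) (by simp) (by simp)
      (by simp) (by simp))

end ChristoffelVectors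

/-! ### Test fields dual to coordinate vectors -/

section DualFields

variable {n : ℕ} {M : Type*} [TopologicalSpace M] [ChartedSpace (Eu n) M]
  [IsManifold (𝓡 n) ∞ M] {k : ℕ}

/-- The tensor `g(X₁, ·) ⊗ ⋯ ⊗ g(X_k, ·)`. -/
def dualTensor (g : RiemMetric n M) (x : M) (X : Fin k → Eu n) :
    MultilinearMap ℝ (fun _ : Fin k => TangentSpace (𝓡 n) x) ℝ :=
  (MultilinearMap.mkPiAlgebra ℝ (Fin k) ℝ).compLinearMap
    fun j => (g.inner x (X j)).toLinearMap

open Classical in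
/-- The tensor field `c • g(∂_{I 0}, ·) ⊗ ⋯ ⊗ g(∂_{I (k-1)}, ·)` in the chart `e`, extended by zero
outside of the domain of the chart. -/
def dualField (g : RiemMetric n M) (e : OpenPartialHomeomorph M (Eu n)) (I : Fin k → Fin n)
    (c : Eu n → ℝ) : TensorField n M k := fun x =>
  if x ∈ e.source then c (e x) • dualTensor g x fun j => dSymm e (e x) (stdVec (I j)) else 0

theorem dualField_of_mem (g : RiemMetric n M) {e : OpenPartialHomeomorph M (Eu n)}
    (I : Fin k → Fin n) (c : Eu n → ℝ) {x : M} (hx : x ∈ e.source) :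
    dualField g e I c x =
      c (e x) • dualTensor g x fun j => dSymm e (e x) (stdVec (I j)) := if_pos hx

theorem dualField_of_notMem (g : RiemMetric n M) {e : OpenPartialHomeomorph M (Eu n)}
    (I : Fin k → Fin n) (c : Eu n → ℝ) {x : M} (hx : x ∉ e.source) :
    dualField g e I c x = 0 := if_neg hx

theorem innerE_dSymm (g : RiemMetric n M) {e e' : OpenPartialHomeomorph M (Eu n)}
    (he : e ∈ smoothCharts n M) (he' : e' ∈ smoothCharts n M) {y : Eu n} (hy : y ∈ e'.target)
    (hy' : e'.symm y ∈ e.source) (v w : Eu n) :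
    innerE g (e'.symm y) (dSymm e (e (e'.symm y)) v) (dSymm e' y w) =
      metForm g e (transition e e' y) v (fderiv ℝ (transition e e') y w) := by
  rw [metForm_apply, dSymm_fderiv_transition he he' hy hy', transition, e.left_inv hy']

theorem comp_dualField (g : RiemMetric n M) {e e' : OpenPartialHomeomorph M (Eu n)}
    (he : e ∈ smoothCharts n M) (he' : e' ∈ smoothCharts n M) {y : Eu n} (hy : y ∈ e'.target)
    (hy' : e'.symm y ∈ e.source) (I J : Fin k → Fin n) (c : Eu n → ℝ) :
    comp e' (dualField g e I c) J y = c (transition e e' y) *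
      ∏ j, metForm g e (transition e e' y) (stdVec (I j))
        (fderiv ℝ (transition e e') y (stdVec (J j))) := by
  rw [comp, dualField_of_mem g I c hy']
  simp only [← innerE_dSymm g he he' hy hy']
  rfl

theorem dualField_eq_zero_of_notMem (g : RiemMetric n M) {e : OpenPartialHomeomorph M (Eu n)}
    (I : Fin k → Fin n) {c : Eu n → ℝ} {x : M} (hx : x ∉ e.symm '' tsupport c) :
    dualField g e I c x = 0 := by
  by_cases h : x ∈ e.source
  · rw [dualField_of_mem g I c h, image_eq_zero_of_notMem_tsupport (f := c), zero_smul]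
    exact fun h' => hx ⟨e x, h', e.left_inv h⟩
  · exact dualField_of_notMem g I c h

theorem isCompactlySupported_dualField (g : RiemMetric n M) {e : OpenPartialHomeomorph M (Eu n)}
    (I : Fin k → Fin n) {c : Eu n → ℝ} (hc : HasCompactSupport c) (hct : tsupport c ⊆ e.target) :
    IsCompactlySupported (dualField g e I c) :=
  ⟨_, isCompact_symm_image_tsupport hc hct, fun _ => dualField_eq_zero_of_notMem g I⟩

/-- In a Hausdorff space the compact image of the support is closed, so a point outside the chart
domain has a whole neighbourhood where the field vanishes. This makes the extension by zero smooth.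
-/
theorem comp_dualField_eventuallyEq_zero [T2Space M] (g : RiemMetric n M)
    {e e' : OpenPartialHomeomorph M (Eu n)} {y : Eu n} (hy : y ∈ e'.target)
    (hy' : e'.symm y ∉ e.source) (I J : Fin k → Fin n) {c : Eu n → ℝ} (hc : HasCompactSupport c)
    (hct : tsupport c ⊆ e.target) :
    comp e' (dualField g e I c) J =ᶠ[nhds y] 0 := by
  have hK : IsClosed (e.symm '' tsupport c) := (isCompact_symm_image_tsupport hc hct).isClosed
  have hyK : e'.symm y ∈ (e.symm '' tsupport c)ᶜ := by
    rintro ⟨z, hz, h⟩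
    exact hy' (h ▸ e.map_target (hct hz))
  filter_upwards [(e'.symm.continuousAt hy).eventually_mem (hK.isOpen_compl.mem_nhds hyK)] with z hz
  rw [comp, dualField_eq_zero_of_notMem g I hz]
  rfl

theorem isSmoothTensor_dualField [T2Space M] (g : RiemMetric n M)
    {e : OpenPartialHomeomorph M (Eu n)} (he : e ∈ smoothCharts n M) (I : Fin k → Fin n)
    {c : Eu n → ℝ} (hcd : ContDiff ℝ ∞ c) (hc : HasCompactSupport c)
    (hct : tsupport c ⊆ e.target) : IsSmoothTensor (dualField g e I c) := by
  intro e' he' J y hy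
  refine ContDiffAt.contDiffWithinAt ?_
  by_cases hy' : e'.symm y ∈ e.source
  · have h1 : comp e' (dualField g e I c) J =ᶠ[nhds y] fun z => c (transition e e' z) *
        ∏ j, metForm g e (transition e e' z) (stdVec (I j))
          (fderiv ℝ (transition e e') z (stdVec (J j))) :=
      (eventually_mem_source hy hy').mono fun z hz => comp_dualField g he he' hz.1 hz.2 I J c
    refine ContDiffAt.congr_of_eventuallyEq ?_ h1
    have hφ := contDiffAt_transition he he' hy hy'
    have hB : ContDiffAt ℝ ∞ (fun z => metForm g e (transition e e' z)) y :=
      ContDiffAt.comp (g := metForm g e) y ((contDiffOn_metForm g he).contDiffAt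
        (e.open_target.mem_nhds (transition_mem_target hy'))) hφ
    refine (hcd.contDiffAt.comp y hφ).mul (contDiffAt_prod fun j _ => ?_)
    exact (hB.clm_apply contDiffAt_const).clm_apply
      ((hφ.fderiv_right (m := ∞) (by simp)).clm_apply contDiffAt_const)
  · exact contDiffAt_const.congr_of_eventuallyEq
      (comp_dualField_eventuallyEq_zero g hy hy' I J hc hct)

end DualFields

/-! ### Tensors and their components; pairing with dual tensors -/

section Components

variable {n : ℕ} {M : Type*} [TopologicalSpace M] [ChartedSpace (Eu n) M] {k : ℕ}

theorem multilinearMap_apply_sum_smul {V : Type*} [AddCommGroup V] [Module ℝ V]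
    (T : MultilinearMap ℝ (fun _ : Fin k => V) ℝ) (a : Fin k → Fin n → ℝ) (f : Fin n → V) :
    T (fun m => ∑ i, a m i • f i) = ∑ I : Fin k → Fin n, (∏ m, a m (I m)) * T fun m => f (I m) := by
  rw [MultilinearMap.map_sum]
  exact Finset.sum_congr rfl fun I _ => T.map_smul_univ _ _

/-- The base point `e.symm (e x)` is only propositionally equal to `x`, so the dependent evaluation
is transported once, here. -/
theorem comp_apply_chart {e : OpenPartialHomeomorph M (Eu n)} {x : M} (hx : x ∈ e.source)
    (T : TensorField n M k) (I : Fin k → Fin n) :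
    comp e T I (e x) = T x fun j => (dSymm e (e x) (stdVec (I j)) : Eu n) := by
  have h (x' : M) (h' : x' = x) (v : Fin k → Eu n) : T x' v = T x v := by subst h'; rfl
  exact h _ (e.left_inv hx) _

theorem sum_dChart_smul_dSymm {e : OpenPartialHomeomorph M (Eu n)} (he : e ∈ smoothCharts n M)
    {x : M} (hx : x ∈ e.source) (v : Eu n) :
    ∑ i, dChart e x v i • dSymm e (e x) (stdVec i) = v := by
  conv_rhs => rw [← dSymm_dChart he hx v, ← sum_stdVec (dChart e x v)]
  simp only [map_sum, map_smul]

/-- Evaluation of tensors at vectors of the model space. -/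
def evalAt (x : M) (v : Fin k → Eu n) :
    MultilinearMap ℝ (fun _ : Fin k => TangentSpace (𝓡 n) x) ℝ →ₗ[ℝ] ℝ where
  toFun T := T v
  map_add' _ _ := rfl
  map_smul' _ _ := rfl

/-- A tensor is determined by its components. -/
theorem ofComp_eq {e : OpenPartialHomeomorph M (Eu n)} (he : e ∈ smoothCharts n M)
    {x : M} (hx : x ∈ e.source) (T : MultilinearMap ℝ (fun _ : Fin k => TangentSpace (𝓡 n) x) ℝ)
    (c : (Fin k → Fin n) → ℝ)
    (hc : ∀ J, c J = evalAt x (fun j => dSymm e (e x) (stdVec (J j))) T) : ofComp e x c = T := by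
  ext v
  have h1 : T v = T fun m => ∑ i, (dChart e x (v m) i • dSymm e (e x) (stdVec i) : Eu n) :=
    congrArg T (funext fun m => (sum_dChart_smul_dSymm he hx (v m)).symm)
  rw [h1]
  refine Eq.trans ?_ (multilinearMap_apply_sum_smul (V := TangentSpace (𝓡 n) x) T
    (fun m i => dChart e x (v m) i) _).symm
  rw [ofComp, sum_apply]
  refine Finset.sum_congr rfl fun J _ => ?_
  rw [hc, mul_comm]
  rfl

variable [IsManifold (𝓡 n) ∞ M]

theorem chartAt_mem_smoothCharts (x : M) : chartAt (Eu n) x ∈ smoothCharts n M :=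
  IsManifold.chart_mem_maximalAtlas x

/-- The scalar product of a tensor with a dual tensor is an evaluation. -/
theorem tensorInner_dualField (g : RiemMetric n M) {e : OpenPartialHomeomorph M (Eu n)}
    (he : e ∈ smoothCharts n M) {x : M} (hx : x ∈ e.source) (S : TensorField n M k)
    (I : Fin k → Fin n) (c : Eu n → ℝ) :
    tensorInner g S (dualField g e I c) x = c (e x) * comp e S I (e x) := by
  set e' := chartAt (Eu n) x with he'_def
  have he' : e' ∈ smoothCharts n M := chartAt_mem_smoothCharts x
  have hx' : x ∈ e'.source := mem_chart_source _ x
  have hy : e' x ∈ e'.target := e'.map_source hx'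
  have hsx : e'.symm (e' x) = x := e'.left_inv hx'
  have hy' : e'.symm (e' x) ∈ e.source := by rwa [hsx]
  have ht : transition e e' (e' x) = e x := by rw [transition, hsx]
  -- The coefficients of ∂_{I m} of the chart `e` in the coordinate basis of `e'`, obtained by
  -- raising the index of its dual covector.
  set a : Fin k → Fin n → ℝ := fun m i => ∑ j, gInv g e' (e' x) i j *
    metForm g e (e x) (stdVec (I m)) (fderiv ℝ (transition e e') (e' x) (stdVec j)) with ha
  have h1 (m : Fin k) : ∑ i, a m i • dSymm e' (e' x) (stdVec i) =
      dSymm e (e x) (stdVec (I m)) := by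
    have h2 := (isInner_metForm g he (transition_mem_target hy')).sum_inv_gram_smul
      (linearIndependent_fderiv_transition he he' hy hy') (stdVec (I m))
    rw [← gInv_eq_gram_transition g he he' hy hy', ht] at h2
    conv_rhs => rw [← h2]
    simp only [map_sum, map_smul, ha, Finset.sum_smul]
    refine Finset.sum_congr rfl fun i _ => Finset.sum_congr rfl fun j _ => ?_
    have h3 := dSymm_fderiv_transition he he' hy hy' (stdVec i)
    rw [ht] at h3
    rw [h3, metForm_symm]
  have h4 : comp e S I (e x) = ∑ I', (∏ m, a m (I' m)) * comp e' S I' (e' x) := by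
    simp only [comp_apply_chart hx, comp_apply_chart hx']
    refine Eq.trans ?_ (multilinearMap_apply_sum_smul (V := TangentSpace (𝓡 n) x) (S x) a
      fun i => dSymm e' (e' x) (stdVec i))
    exact congrArg (S x) (funext fun m => (h1 m).symm)
  change ∑ I' : Fin k → Fin n, ∑ J : Fin k → Fin n, (∏ m, gInv g e' (e' x) (I' m) (J m)) *
    comp e' S I' (e' x) * comp e' (dualField g e I c) J (e' x) = _
  rw [h4, Finset.mul_sum]
  refine Finset.sum_congr rfl fun I' _ => ?_
  have h5 : ∏ m, a m (I' m) = ∑ J : Fin k → Fin n, ∏ m, gInv g e' (e' x) (I' m) (J m) *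
      metForm g e (e x) (stdVec (I m)) (fderiv ℝ (transition e e') (e' x) (stdVec (J m))) := by
    simp only [ha, Finset.prod_univ_sum, Fintype.piFinset_univ]
  rw [h5, Finset.sum_mul, Finset.mul_sum]
  refine Finset.sum_congr rfl fun J _ => ?_
  rw [comp_dualField g he he' hy hy', ht, Finset.prod_mul_distrib]
  ring

end Components

/-! ### Covariant derivative and divergence of dual fields -/

section CovariantDerivative

variable {n : ℕ} {M : Type*} [TopologicalSpace M] [ChartedSpace (Eu n) M]
  [IsManifold (𝓡 n) ∞ M] {k : ℕ}

theorem prod_update_eq_mul_prod_erase {ι : Type*} [Fintype ι] [DecidableEq ι] (f : ι → ℝ) (i : ι)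
    (z : ℝ) : ∏ j, Function.update f i z j = z * ∏ j ∈ Finset.univ.erase i, f j := by
  rw [← Finset.mul_prod_erase _ _ (Finset.mem_univ i), Function.update_self]
  congr 1
  exact Finset.prod_congr rfl fun j hj => Function.update_of_ne (Finset.ne_of_mem_erase hj) _ _

theorem prod_apply_update {ι κ : Type*} [Fintype ι] [DecidableEq ι] (f : ι → κ → ℝ) (J : ι → κ)
    (i : ι) (l : κ) :
    ∏ j, f j (Function.update J i l j) = ∏ j, Function.update (fun j => f j (J j)) i (f i l) j := by
  refine Finset.prod_congr rfl fun j _ => ?_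
  rcases eq_or_ne j i with rfl | h
  · simp
  · simp [h]

theorem sum_mul_prod_update {ι κ : Type*} [Fintype ι] [DecidableEq ι] [Fintype κ] (f : ι → ℝ)
    (i : ι) (a z : κ → ℝ) :
    ∑ l, a l * ∏ j, Function.update f i (z l) j = ∏ j, Function.update f i (∑ l, a l * z l) j := by
  simp only [prod_update_eq_mul_prod_erase, Finset.sum_mul, mul_assoc]

/-- The covariant derivative of a dual field. -/
theorem covComp_dualField (g : RiemMetric n M) {e e' : OpenPartialHomeomorph M (Eu n)}
    (he : e ∈ smoothCharts n M) (he' : e' ∈ smoothCharts n M) {y : Eu n} (hy : y ∈ e'.target)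
    (hy' : e'.symm y ∈ e.source) (I J : Fin k → Fin n) {c : Eu n → ℝ}
    (hc : DifferentiableAt ℝ c (transition e e' y)) (a : Fin n) :
    covComp g e' (dualField g e I c) a J y =
      fderiv ℝ c (transition e e' y) (fderiv ℝ (transition e e') y (stdVec a)) *
        ∏ j, metForm g e (transition e e' y) (stdVec (I j))
          (fderiv ℝ (transition e e') y (stdVec (J j))) +
      c (transition e e' y) * ∑ μ, ∏ j, Function.update
        (fun j => metForm g e (transition e e' y) (stdVec (I j))
          (fderiv ℝ (transition e e') y (stdVec (J j)))) μ
        (metForm g e (transition e e' y)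
          (chrVec (metForm g e) (transition e e' y) (fderiv ℝ (transition e e') y (stdVec a))
            (stdVec (I μ))) (fderiv ℝ (transition e e') y (stdVec (J μ)))) j := by
  set φ := transition e e' with hφ_def
  have hφ : ContDiffAt ℝ ∞ φ y := contDiffAt_transition he he' hy hy'
  have hφy := transition_mem_target hy'
  set f : Fin k → Eu n → ℝ := fun j z =>
    metForm g e (φ z) (stdVec (I j)) (fderiv ℝ φ z (stdVec (J j))) with hf
  have hB := differentiableAt_metForm g he hφy
  have hfd (j) : DifferentiableAt ℝ (f j) y := by
    obtain ⟨L, hL, -⟩ := hasFDerivAt_inner_fderiv hφ hB (stdVec (I j)) (stdVec (J j))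
    exact hL.differentiableAt
  have hcφ : HasFDerivAt (fun z => c (φ z)) ((fderiv ℝ c (φ y)).comp (fderiv ℝ φ y)) y :=
    HasFDerivAt.comp (g := c) y hc.hasFDerivAt (hφ.differentiableAt (by simp)).hasFDerivAt
  have hev : comp e' (dualField g e I c) J =ᶠ[nhds y] fun z => c (φ z) * ∏ j, f j z :=
    (eventually_mem_source hy hy').mono fun z hz => comp_dualField g he he' hz.1 hz.2 I J c
  have h1 : partialD a (comp e' (dualField g e I c) J) y =
      fderiv ℝ c (φ y) (fderiv ℝ φ y (stdVec a)) * ∏ j, f j y +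
      c (φ y) * ∑ μ, ∏ j, Function.update (fun j => f j y) μ
        (fderiv ℝ (f μ) y (stdVec a)) j := by
    rw [partialD, hev.fderiv_eq,
      (hcφ.fun_mul (HasFDerivAt.finsetProd fun j _ => (hfd j).hasFDerivAt)).fderiv]
    simp only [add_apply, smul_apply, sum_apply, ContinuousLinearMap.comp_apply, smul_eq_mul,
      prod_update_eq_mul_prod_erase]
    rw [add_comm, mul_comm (∏ j, f j y)]
    congr 2
    exact Finset.sum_congr rfl fun _ _ => mul_comm _ _
  have h2 : christoffelSum g e' (dualField g e I c) a J y =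
      c (φ y) * ∑ μ, ∏ j, Function.update (fun j => f j y) μ
        (metForm g e (φ y) (stdVec (I μ))
          (fderiv ℝ φ y (chrVec (metForm g e') y (stdVec a) (stdVec (J μ))))) j := by
    rw [christoffelSum, Finset.mul_sum]
    refine Finset.sum_congr rfl fun μ _ => ?_
    rw [chrVec_metForm g he' hy]
    simp only [map_sum, map_smul, smul_eq_mul, ← sum_mul_prod_update]
    rw [Finset.mul_sum]
    refine Finset.sum_congr rfl fun l _ => ?_
    rw [comp_dualField g he he' hy hy', prod_apply_update (fun j i =>
      metForm g e (transition e e' y) (stdVec (I j))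
        (fderiv ℝ (transition e e') y (stdVec i)))]
    ring
  have h3 : ∀ᶠ z in nhds y, ∀ v w, metForm g e' z v w =
      metForm g e (φ z) (fderiv ℝ φ z v) (fderiv ℝ φ z w) :=
    (eventually_mem_source hy hy').mono fun z hz => metForm_transition g he he' hz.1 hz.2
  -- The derivative of each factor combines with the Christoffel term of the same slot into the
  -- covariant derivative of one dual covector.
  rw [covComp, h1, h2, add_sub_assoc, ← mul_sub, ← Finset.sum_sub_distrib]
  congr 2
  refine Finset.sum_congr rfl fun μ _ => ?_
  rw [← fderiv_inner_sub_chrVec hφ (surjective_fderiv_transition he he' hy hy') hB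
    (differentiableAt_metForm g he' hy) (metForm_symm g e) (isInner_metForm g he hφy)
    (isInner_metForm g he' hy) h3]
  simp only [prod_update_eq_mul_prod_erase, sub_mul]
  rfl

/-- The divergence of a dual field, in an arbitrary chart. -/
theorem sum_gInv_mul_covComp_dualField (g : RiemMetric n M)
    {e e' : OpenPartialHomeomorph M (Eu n)}
    (he : e ∈ smoothCharts n M) (he' : e' ∈ smoothCharts n M) {y : Eu n} (hy : y ∈ e'.target)
    (hy' : e'.symm y ∈ e.source) (I : Fin (k + 1) → Fin n) (J : Fin k → Fin n) {ψ : Eu n → ℝ}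
    (hψ : DifferentiableAt ℝ ψ (transition e e' y)) :
    ∑ a, ∑ b, gInv g e' y a b * covComp g e'
        (dualField g e I fun z => ψ z / density (metForm g e) z) a
        (Fin.snoc (α := fun _ => Fin n) J b) y =
      partialD (I (Fin.last k)) ψ (transition e e' y) / density (metForm g e) (transition e e' y) *
        ∏ j, metForm g e (transition e e' y) (stdVec (I (Fin.castSucc j)))
          (fderiv ℝ (transition e e') y (stdVec (J j))) +
      ψ (transition e e' y) / density (metForm g e) (transition e e' y) *
        ∑ μ, ∏ j, Function.update
          (fun j => metForm g e (transition e e' y) (stdVec (I (Fin.castSucc j)))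
            (fderiv ℝ (transition e e') y (stdVec (J j)))) μ
          (metForm g e (transition e e' y)
            (chrVec (metForm g e) (transition e e' y) (stdVec (I (Fin.last k)))
              (stdVec (I (Fin.castSucc μ)))) (fderiv ℝ (transition e e') y (stdVec (J μ)))) j := by
  have hpt : transition e e' y ∈ e.target := transition_mem_target hy'
  have hb := isInner_metForm g he hpt
  obtain ⟨L, hL, hLa⟩ := hasFDerivAt_density (differentiableAt_metForm g he hpt)
    (metForm_symm g e) hb
  have hρ := (density_pos hb).ne'
  have hc : HasFDerivAt (fun z => ψ z / density (metForm g e) z) _ (transition e e' y) :=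
    hψ.hasFDerivAt.fun_mul ((hasDerivAt_inv hρ).comp_hasFDerivAt _ hL)
  set c : Eu n → ℝ := fun z => ψ z / density (metForm g e) z with hc_def
  set p := transition e e' y with hp
  set F := fderiv ℝ (transition e e') y with hF
  set P : Fin k → ℝ := fun j => metForm g e p (stdVec (I (Fin.castSucc j))) (F (stdVec (J j)))
    with hP
  -- Three contributions: the derivative of the coefficient, the Christoffel vectors of the first
  -- `k` slots, and that of the last slot, which is about to be contracted.
  have hcov (a b : Fin n) : covComp g e' (dualField g e I c) a
      (Fin.snoc (α := fun _ => Fin n) J b) y =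
      (∏ j, P j) * (fderiv ℝ c p (F (stdVec a)) *
        metForm g e p (stdVec (I (Fin.last k))) (F (stdVec b))) +
      c p * (∑ μ, (∏ j ∈ Finset.univ.erase μ, P j) *
        (metForm g e p (chrVec (metForm g e) p (F (stdVec a)) (stdVec (I (Fin.castSucc μ))))
          (F (stdVec (J μ))) * metForm g e p (stdVec (I (Fin.last k))) (F (stdVec b)))) +
      c p * (∏ j, P j) * metForm g e p
        (chrVec (metForm g e) p (F (stdVec a)) (stdVec (I (Fin.last k)))) (F (stdVec b)) := by
    rw [covComp_dualField g he he' hy hy' I _ hc.differentiableAt, Fin.sum_univ_castSucc,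
      Fin.prod_univ_castSucc]
    have h1 (μ : Fin k) (z : ℝ) : ∏ j, Function.update (fun j : Fin (k + 1) =>
        metForm g e p (stdVec (I j)) (F (stdVec (Fin.snoc (α := fun _ => Fin n) J b j))))
        (Fin.castSucc μ) z j = (∏ j ∈ Finset.univ.erase μ, P j) *
          (z * metForm g e p (stdVec (I (Fin.last k))) (F (stdVec b))) := by
      rw [Fin.prod_univ_castSucc, Function.update_of_ne (Fin.castSucc_ne_last μ).symm]
      have h2 : ∏ j : Fin k, Function.update (fun j : Fin (k + 1) =>
          metForm g e p (stdVec (I j)) (F (stdVec (Fin.snoc (α := fun _ => Fin n) J b j))))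
          (Fin.castSucc μ) z (Fin.castSucc j) = ∏ j, Function.update P μ z j := by
        refine Finset.prod_congr rfl fun j _ => ?_
        rcases eq_or_ne j μ with rfl | h
        · simp
        · simp [h, hP]
      rw [h2, prod_update_eq_mul_prod_erase, Fin.snoc_last]
      ring
    have h3 (z : ℝ) : ∏ j, Function.update (fun j : Fin (k + 1) =>
        metForm g e p (stdVec (I j)) (F (stdVec (Fin.snoc (α := fun _ => Fin n) J b j))))
        (Fin.last k) z j = (∏ j, P j) * z := by
      rw [Fin.prod_univ_castSucc, Function.update_self]
      congr 1
      refine Finset.prod_congr rfl fun j _ => ?_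
      rw [Function.update_of_ne (Fin.castSucc_ne_last j), Fin.snoc_castSucc]
    simp only [← hp, ← hF, h1, h3, Fin.snoc_castSucc, Fin.snoc_last]
    ring
  have hS1 (w : Eu n) := sum_gInv_mul_inner g he he' hy hy' (fderiv ℝ c p).toLinearMap w
  have hS2 (μ : Fin k) := sum_gInv_mul_inner g he he' hy hy'
    ((((metForm g e p).flip (F (stdVec (J μ)))).toLinearMap).comp
      (chrLin hb (stdVec (I (Fin.castSucc μ))))) (stdVec (I (Fin.last k)))
  have hS3 := sum_gInv_mul_chrVec g he he' hy hy' (stdVec (I (Fin.last k)))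
  simp only [← hp, ← hF, LinearMap.comp_apply, ContinuousLinearMap.coe_coe, chrLin_apply,
    ContinuousLinearMap.flip_apply] at hS1 hS2 hS3
  simp only [hcov, mul_add, Finset.sum_add_distrib]
  have e1 : ∑ a, ∑ b, gInv g e' y a b * ((∏ j, P j) * (fderiv ℝ c p (F (stdVec a)) *
      metForm g e p (stdVec (I (Fin.last k))) (F (stdVec b)))) =
      (∏ j, P j) * fderiv ℝ c p (stdVec (I (Fin.last k))) := by
    rw [← hS1]
    simp only [Finset.mul_sum]
    exact Finset.sum_congr rfl fun a _ => Finset.sum_congr rfl fun b _ => by ring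
  have e2 : ∑ a, ∑ b, gInv g e' y a b * (c p * (∑ μ, (∏ j ∈ Finset.univ.erase μ, P j) *
        (metForm g e p (chrVec (metForm g e) p (F (stdVec a)) (stdVec (I (Fin.castSucc μ))))
          (F (stdVec (J μ))) * metForm g e p (stdVec (I (Fin.last k))) (F (stdVec b))))) =
      c p * ∑ μ, (∏ j ∈ Finset.univ.erase μ, P j) *
        metForm g e p (chrVec (metForm g e) p (stdVec (I (Fin.last k)))
          (stdVec (I (Fin.castSucc μ)))) (F (stdVec (J μ))) := by
    simp only [← hS2, Finset.mul_sum]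
    calc _ = ∑ a, ∑ μ, ∑ b, _ := Finset.sum_congr rfl fun a _ => Finset.sum_comm
      _ = ∑ μ, ∑ a, ∑ b, _ := Finset.sum_comm
      _ = _ := Finset.sum_congr rfl fun μ _ => Finset.sum_congr rfl fun a _ =>
        Finset.sum_congr rfl fun b _ => by ring
  -- The last slot gives the trace of the Christoffel symbols, which is the logarithmic derivative
  -- of the density; it cancels the derivative of 1/ρ in `e4`.
  have e3 : ∑ a, ∑ b, gInv g e' y a b * (c p * (∏ j, P j) * metForm g e p
        (chrVec (metForm g e) p (F (stdVec a)) (stdVec (I (Fin.last k)))) (F (stdVec b))) =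
      (∏ j, P j) * (c p * (L (stdVec (I (Fin.last k))) / density (metForm g e) p)) := by
    rw [hLa, mul_div_cancel_left₀ _ hρ, ← hS3]
    simp only [Finset.mul_sum]
    exact Finset.sum_congr rfl fun a _ => Finset.sum_congr rfl fun b _ => by ring
  rw [e1, e2, e3]
  have e4 : fderiv ℝ c p (stdVec (I (Fin.last k))) =
      partialD (I (Fin.last k)) ψ p / density (metForm g e) p -
        c p * (L (stdVec (I (Fin.last k))) / density (metForm g e) p) := by
    rw [hc.fderiv, partialD]
    simp [hc_def]
    field_simp
    ring
  rw [e4]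
  simp only [prod_update_eq_mul_prod_erase, mul_comm (metForm g e p (chrVec _ _ _ _) _)]
  ring

end CovariantDerivative

/-! ### The formal adjoint on dual fields -/

section Adjoint

variable {n : ℕ} {M : Type*} [TopologicalSpace M] [ChartedSpace (Eu n) M]
  [IsManifold (𝓡 n) ∞ M] {k : ℕ}

theorem evalAt_dualTensor (g : RiemMetric n M) (x : M) (X v : Fin k → Eu n) :
    evalAt x v (dualTensor g x X) = ∏ j, innerE g x (X j) (v j) := rfl

/-- The adjoint `∇*` on dual fields. -/
theorem covAdjoint_dualField [T2Space M] (g : RiemMetric n M)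
    {e : OpenPartialHomeomorph M (Eu n)} (he : e ∈ smoothCharts n M) (I : Fin k → Fin n)
    (a : Fin n) {ψ : Eu n → ℝ} (hψ : ContDiff ℝ ∞ ψ) (hψc : HasCompactSupport ψ)
    (hψt : tsupport ψ ⊆ e.target) :
    covAdjoint g (dualField g e (Fin.snoc (α := fun _ => Fin n) I a)
        fun z => ψ z / density (metForm g e) z) =
      -dualField g e I (fun z => partialD a ψ z / density (metForm g e) z) -
        ∑ μ, ∑ l, dualField g e (Function.update I μ l) fun z =>
          ψ z / density (metForm g e) z * christoffel g e a (I μ) l z := by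
  funext x
  set e' := chartAt (Eu n) x with he'_def
  have he' : e' ∈ smoothCharts n M := chartAt_mem_smoothCharts x
  have hx' : x ∈ e'.source := mem_chart_source _ x
  have hy : e' x ∈ e'.target := e'.map_source hx'
  have hsx : e'.symm (e' x) = x := e'.left_inv hx'
  by_cases hx : x ∈ e.source
  · have hy' : e'.symm (e' x) ∈ e.source := by rwa [hsx]
    have ht : transition e e' (e' x) = e x := by rw [transition, hsx]
    -- The adjoint at `x` is defined by its components in the preferred chart, so it suffices to
    -- compare components there.
    refine ofComp_eq he' hx' _ _ fun J => ?_
    rw [sum_gInv_mul_covComp_dualField g he he' hy hy' _ _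
      (hψ.contDiffAt.differentiableAt (by simp)), ht]
    have hin (v w : Eu n) : innerE g x (dSymm e (e x) v) (dSymm e' (e' x) w) =
        metForm g e (e x) v (fderiv ℝ (transition e e') (e' x) w) := by
      have h := innerE_dSymm g he he' hy hy' v w
      rwa [hsx, ht] at h
    simp only [Pi.sub_apply, Pi.neg_apply, Finset.sum_apply, dualField_of_mem g _ _ hx,
      map_sub, map_neg, map_sum, map_smul, evalAt_dualTensor,
      hin, smul_eq_mul, Fin.snoc_last, Fin.snoc_castSucc]
    rw [neg_add']
    congr 1
    rw [Finset.mul_sum]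
    refine Finset.sum_congr rfl fun μ _ => ?_
    rw [chrVec_metForm g he (e.map_source hx)]
    simp only [map_sum, map_smul, sum_apply, smul_apply, smul_eq_mul, ← sum_mul_prod_update]
    rw [Finset.mul_sum]
    refine Finset.sum_congr rfl fun l _ => ?_
    rw [prod_apply_update (fun j i => metForm g e (e x) (stdVec i)
      (fderiv ℝ (transition e e') (e' x) (stdVec (J j))))]
    ring
  -- Off the chart domain the field vanishes near `x`, so its derivative vanishes as well as its
  -- value.
  · have hz (J : Fin (k + 1) → Fin n) : comp e' (dualField g e (Fin.snoc (α := fun _ => Fin n) I a)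
        fun z => ψ z / density (metForm g e) z) J =ᶠ[nhds (e' x)] 0 := by
      refine comp_dualField_eventuallyEq_zero g hy (by rwa [hsx]) _ J ?_ ?_
      · simp only [div_eq_mul_inv]
        exact hψc.mul_right (f' := fun z => (density (metForm g e) z)⁻¹)
      · simp only [div_eq_mul_inv]
        exact (tsupport_mul_subset_left).trans hψt
    refine ofComp_eq he' hx' _ _ fun J => ?_
    simp only [Pi.sub_apply, Pi.neg_apply, Finset.sum_apply, dualField_of_notMem g _ _ hx]
    have h0 (b c : Fin n) : covComp g e' (dualField g e (Fin.snoc (α := fun _ => Fin n) I a)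
        fun z => ψ z / density (metForm g e) z) b (Fin.snoc (α := fun _ => Fin n) J c)
        (e' x) = 0 := by
      rw [covComp, christoffelSum, partialD, (hz _).fderiv_eq]
      simp only [(hz _).eq_of_nhds]
      simp
    have h1 : ∑ b, ∑ c, gInv g e' (e' x) b c * covComp g e'
        (dualField g e (Fin.snoc (α := fun _ => Fin n) I a)
          fun z => ψ z / density (metForm g e) z) b (Fin.snoc (α := fun _ => Fin n) J c)
        (e' x) = 0 := by
      simp only [h0, mul_zero, Finset.sum_const_zero]
    refine (congrArg Neg.neg h1).trans ?_
    simp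

end Adjoint

/-! ### Smoothness of the density and of the Christoffel symbols -/

section SmoothCoefficients

variable {n : ℕ}

theorem contDiffOn_det {A : Eu n → Matrix (Fin n) (Fin n) ℝ} {s : Set (Eu n)}
    (hA : ∀ i j, ContDiffOn ℝ ∞ (fun z => A z i j) s) :
    ContDiffOn ℝ ∞ (fun z => (A z).det) s := by
  simp only [Matrix.det_apply']
  exact ContDiffOn.sum fun σ _ => contDiffOn_const.mul (contDiffOn_prod fun i _ => hA _ _)

theorem contDiffOn_inv_apply {A : Eu n → Matrix (Fin n) (Fin n) ℝ} {s : Set (Eu n)}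
    (hA : ∀ i j, ContDiffOn ℝ ∞ (fun z => A z i j) s) (h0 : ∀ z ∈ s, (A z).det ≠ 0)
    (i j : Fin n) : ContDiffOn ℝ ∞ (fun z => (A z)⁻¹ i j) s := by
  have h : (fun z => (A z)⁻¹ i j) = fun z => (A z).det⁻¹ * (A z).adjugate i j := by
    funext z
    rw [Matrix.inv_def, Ring.inverse_eq_inv']
    rfl
  rw [h]
  refine ((contDiffOn_det hA).inv h0).mul ?_
  simp only [Matrix.adjugate_apply]
  refine contDiffOn_det fun a b => ?_
  by_cases hab : a = j
  · subst hab
    simpa only [Matrix.updateRow_self] using contDiffOn_const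
  · simpa only [Matrix.updateRow_ne hab] using hA a b

/-- The product of a test function with a smooth function on an open set, as a test function. -/
theorem contDiff_mul_of_tsupport_subset {f ψ : Eu n → ℝ} {D : Set (Eu n)} (hD : IsOpen D)
    (hψ : ContDiff ℝ ∞ ψ) (hψt : tsupport ψ ⊆ D) (hf : ContDiffOn ℝ ∞ f D) :
    ContDiff ℝ ∞ fun z => ψ z * f z := by
  refine (contMDiff_of_tsupport fun x hx => ContDiffAt.contMDiffAt ?_).contDiff
  exact hψ.contDiffAt.mul (hf.contDiffAt (hD.mem_nhds (hψt (tsupport_mul_subset_left hx))))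

variable {M : Type*} [TopologicalSpace M] [ChartedSpace (Eu n) M] [IsManifold (𝓡 n) ∞ M]
  {e : OpenPartialHomeomorph M (Eu n)}

theorem contDiffOn_gMat (g : RiemMetric n M) (he : e ∈ smoothCharts n M) (i j : Fin n) :
    ContDiffOn ℝ ∞ (fun z => gMat g e z i j) e.target :=
  ((contDiffOn_metForm g he).clm_apply contDiffOn_const).clm_apply contDiffOn_const

theorem det_gMat_pos (g : RiemMetric n M) (he : e ∈ smoothCharts n M) {y : Eu n}
    (hy : y ∈ e.target) : 0 < (gMat g e y).det :=
  (isInner_metForm g he hy).gram_posDef.det_pos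

theorem contDiffOn_density (g : RiemMetric n M) (he : e ∈ smoothCharts n M) :
    ContDiffOn ℝ ∞ (density (metForm g e)) e.target :=
  (contDiffOn_det (contDiffOn_gMat g he)).sqrt fun _ hz => (det_gMat_pos g he hz).ne'

theorem density_metForm_pos (g : RiemMetric n M) (he : e ∈ smoothCharts n M) {y : Eu n}
    (hy : y ∈ e.target) : 0 < density (metForm g e) y :=
  density_pos (isInner_metForm g he hy)

theorem contDiffOn_christoffel (g : RiemMetric n M) (he : e ∈ smoothCharts n M)
    (i j l : Fin n) : ContDiffOn ℝ ∞ (christoffel g e i j l) e.target := by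
  have hp (a b c : Fin n) :
      ContDiffOn ℝ ∞ (fun y => partialD a (fun z => gMat g e z b c) y) e.target :=
    ((contDiffOn_gMat g he b c).fderiv_of_isOpen e.open_target (m := ∞) (by simp)).clm_apply
      contDiffOn_const
  refine contDiffOn_const.mul (ContDiffOn.sum fun m _ => ?_)
  exact (contDiffOn_inv_apply (contDiffOn_gMat g he) (fun z hz => (det_gMat_pos g he hz).ne')
    l m).mul (((hp _ _ _).add (hp _ _ _)).sub (hp _ _ _))

end SmoothCoefficients

/-! ### The Riemannian volume in coordinates -/

section Volume

variable {n : ℕ} {M : Type*} [TopologicalSpace M]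

section Measurability

variable [MeasurableSpace M] [BorelSpace M]

/-- Nothing is known about `e.symm` off the target, so integrals are moved through the subtype; for
the same reason the measures below are assumed to be concentrated on the target. -/
theorem measurableEmbedding_symm (e : OpenPartialHomeomorph M (Eu n)) :
    MeasurableEmbedding fun y : e.target => e.symm y := by
  have h : Topology.IsOpenEmbedding fun y : e.target => e.symm y :=
    (e.open_source.isOpenEmbedding_subtypeVal).comp
      e.toHomeomorphSourceTarget.symm.isOpenEmbedding
  exact h.measurableEmbedding

theorem aemeasurable_symm (e : OpenPartialHomeomorph M (Eu n)) {μ : Measure (Eu n)}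
    (hμ : μ.restrict e.target = μ) : AEMeasurable e.symm μ := by
  rw [← hμ]
  exact e.continuousOn_symm.aemeasurable e.open_target.measurableSet

theorem map_symm_eq_map_subtype (e : OpenPartialHomeomorph M (Eu n)) {μ : Measure (Eu n)}
    (hμ : μ.restrict e.target = μ) :
    μ.map e.symm = (μ.comap Subtype.val).map fun y : e.target => e.symm y := by
  have h1 : (μ.comap Subtype.val).map (Subtype.val : e.target → Eu n) = μ :=
    (map_comap_subtype_coe e.open_target.measurableSet μ).trans hμ
  conv_lhs => rw [← h1]
  rw [AEMeasurable.map_map_of_aemeasurable (by rw [h1]; exact aemeasurable_symm e hμ)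
    measurable_subtype_coe.aemeasurable]
  rfl

theorem integral_map_symm (e : OpenPartialHomeomorph M (Eu n)) {μ : Measure (Eu n)}
    (hμ : μ.restrict e.target = μ) (F : M → ℝ) :
    ∫ x, F x ∂(μ.map e.symm) = ∫ y, F (e.symm y) ∂μ := by
  have hT := e.open_target.measurableSet
  have h1 := map_comap_subtype_coe hT μ
  rw [map_symm_eq_map_subtype e hμ, (measurableEmbedding_symm e).integral_map]
  conv_rhs => rw [← hμ, ← h1]
  rw [(MeasurableEmbedding.subtype_coe hT).integral_map]

theorem integrable_map_symm (e : OpenPartialHomeomorph M (Eu n)) {μ : Measure (Eu n)}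
    (hμ : μ.restrict e.target = μ) (F : M → ℝ) :
    Integrable F (μ.map e.symm) ↔ Integrable (fun y => F (e.symm y)) μ := by
  have hT := e.open_target.measurableSet
  have h1 := map_comap_subtype_coe hT μ
  rw [map_symm_eq_map_subtype e hμ, (measurableEmbedding_symm e).integrable_map_iff]
  conv_rhs => rw [← hμ, ← h1]
  rw [(MeasurableEmbedding.subtype_coe hT).integrable_map_iff]
  rfl


theorem measurableSet_symm_preimage_inter (e : OpenPartialHomeomorph M (Eu n)) {s : Set M}
    (hs : MeasurableSet s) : MeasurableSet (e.symm ⁻¹' s ∩ e.target) := by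
  have h : e.symm ⁻¹' s ∩ e.target =
      Subtype.val '' ((fun y : e.target => e.symm y) ⁻¹' s) := by
    ext y
    simp [and_comm]
  rw [h]
  exact e.open_target.measurableSet.subtype_image ((measurableEmbedding_symm e).measurable hs)

end Measurability

variable [ChartedSpace (Eu n) M] [IsManifold (𝓡 n) ∞ M]

/-- The transformation rule of the volume density under a change of coordinates. -/
theorem density_transition (g : RiemMetric n M) {e e' : OpenPartialHomeomorph M (Eu n)}
    (he : e ∈ smoothCharts n M) (he' : e' ∈ smoothCharts n M) {y : Eu n} (hy : y ∈ e'.target)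
    (hy' : e'.symm y ∈ e.source) :
    density (metForm g e') y = |(fderiv ℝ (transition e e') y).det| *
      density (metForm g e) (transition e e' y) := by
  set F := fderiv ℝ (transition e e') y with hF
  set A : Matrix (Fin n) (Fin n) ℝ := Matrix.of fun i j => F (stdVec j) i with hA
  have hFA (j : Fin n) : F (stdVec j) = ∑ i, A i j • stdVec i := (sum_stdVec _).symm
  have h1 : gram (metForm g e' y) =
      A.transpose * gram (metForm g e (transition e e' y)) * A := by
    ext i j
    rw [gram, Matrix.of_apply, metForm_transition g he he' hy hy', ← hF, hFA, hFA]
    simp only [map_sum, map_smul, sum_apply, smul_apply, smul_eq_mul, Matrix.mul_apply,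
      Matrix.transpose_apply, gram, Matrix.of_apply, Finset.sum_mul, Finset.mul_sum]
    exact Finset.sum_congr rfl fun a _ => Finset.sum_congr rfl fun b _ => by ring
  have h2 : F.det = A.det := by
    rw [ContinuousLinearMap.det,
      ← LinearMap.det_toMatrix (EuclideanSpace.basisFun (Fin n) ℝ).toBasis]
    congr 1
  rw [density, h1, Matrix.det_mul, Matrix.det_mul, Matrix.det_transpose, h2, density,
    mul_right_comm, Real.sqrt_mul (mul_self_nonneg _), Real.sqrt_mul_self_eq_abs]

variable {e : OpenPartialHomeomorph M (Eu n)}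

/-- The Riemannian volume in the coordinates of the chart `e`. -/
def coordVol (g : RiemMetric n M) (e : OpenPartialHomeomorph M (Eu n)) : Measure (Eu n) :=
  (volume.restrict e.target).withDensity fun y => ENNReal.ofReal (density (metForm g e) y)

theorem coordVol_restrict (g : RiemMetric n M) :
    (coordVol g e).restrict e.target = coordVol g e := by
  rw [coordVol, restrict_withDensity e.open_target.measurableSet,
    Measure.restrict_restrict e.open_target.measurableSet, inter_self]

theorem aemeasurable_ofReal_density (g : RiemMetric n M) (he : e ∈ smoothCharts n M) :
    AEMeasurable (fun y => ENNReal.ofReal (density (metForm g e) y))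
      (volume.restrict e.target) :=
  ((contDiffOn_density g he).continuousOn.aemeasurable e.open_target.measurableSet).ennreal_ofReal

variable [MeasurableSpace M]

theorem chartVol_eq (g : RiemMetric n M) : chartVol g e = (coordVol g e).map e.symm := rfl

variable [BorelSpace M]

theorem chartVol_apply (g : RiemMetric n M) {s : Set M} (hs : MeasurableSet s) :
    chartVol g e s =
      ∫⁻ y in e.symm ⁻¹' s ∩ e.target, ENNReal.ofReal (density (metForm g e) y) := by
  rw [chartVol_eq, Measure.map_apply_of_aemeasurable
    (aemeasurable_symm e (coordVol_restrict g)) hs, coordVol, withDensity_apply',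
    Measure.restrict_restrict' e.open_target.measurableSet]

/-- Change of variables along the transition map, whose Jacobian is absorbed by the density. The
inequality suffices, since the supremum supplies the opposite bound. -/
theorem chartVol_restrict_le (g : RiemMetric n M) (he : e ∈ smoothCharts n M)
    {e' : OpenPartialHomeomorph M (Eu n)} (he' : e' ∈ smoothCharts n M) :
    (chartVol g e').restrict e.source ≤ chartVol g e := by
  refine Measure.le_iff.2 fun s hs => ?_
  have hs' : MeasurableSet (s ∩ e.source) := hs.inter e.open_source.measurableSet
  rw [Measure.restrict_apply hs, chartVol_apply g hs', chartVol_apply g hs]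
  set A := e'.symm ⁻¹' (s ∩ e.source) ∩ e'.target with hA
  have hAm : MeasurableSet A := measurableSet_symm_preimage_inter e' hs'
  have hinj : InjOn (transition e e') A := by
    intro y hy z hz h
    have h1 : e'.symm y = e'.symm z := e.injOn hy.1.2 hz.1.2 h
    exact e'.symm.injOn hy.2 hz.2 h1
  have hd (y) (hy : y ∈ A) : HasFDerivWithinAt (transition e e')
      (fderiv ℝ (transition e e') y) A y :=
    ((contDiffAt_transition he he' hy.2 hy.1.2).differentiableAt
      (by simp)).hasFDerivAt.hasFDerivWithinAt
  calc ∫⁻ y in A, ENNReal.ofReal (density (metForm g e') y)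
      = ∫⁻ y in A, ENNReal.ofReal |(fderiv ℝ (transition e e') y).det| *
          ENNReal.ofReal (density (metForm g e) (transition e e' y)) := by
        refine setLIntegral_congr_fun hAm fun y hy => ?_
        rw [← ENNReal.ofReal_mul (abs_nonneg _), ← density_transition g he he' hy.2 hy.1.2]
    _ = ∫⁻ y in transition e e' '' A, ENNReal.ofReal (density (metForm g e) y) :=
        (lintegral_image_eq_lintegral_abs_det_fderiv_mul volume hAm hd hinj
          fun y => ENNReal.ofReal (density (metForm g e) y)).symm
    _ ≤ _ := by
        refine lintegral_mono_set ?_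
        rintro _ ⟨y, hy, rfl⟩
        refine ⟨?_, transition_mem_target hy.1.2⟩
        rw [mem_preimage, transition, e.left_inv hy.1.2]
        exact hy.1.1

/-- On the domain of a chart, the Riemannian volume is the measure `√(det g) dx¹ ⋯ dxⁿ`. -/
theorem vol_restrict (g : RiemMetric n M) (he : e ∈ smoothCharts n M) :
    (vol g).restrict e.source = chartVol g e := by
  have hS := e.open_source.measurableSet
  refine le_antisymm ?_ ?_
  -- The right-hand side bounds every chart measure: on the domain of `e` by comparison with
  -- `chartVol g e`, off it by the supremum. It therefore bounds the supremum, and restricting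
  -- removes the second summand.
  · have h1 : vol g ≤ chartVol g e + (vol g).restrict e.sourceᶜ := by
      refine iSup_le fun e' => ?_
      conv_lhs => rw [← Measure.restrict_add_restrict_compl (μ := chartVol g e'.1) hS]
      exact add_le_add (chartVol_restrict_le g he e'.2)
        (Measure.restrict_mono subset_rfl (le_iSup (fun e' : smoothCharts n M =>
          chartVol g (e' : OpenPartialHomeomorph M (Eu n))) e'))
    refine (Measure.restrict_mono subset_rfl h1).trans ?_
    rw [Measure.restrict_add, Measure.restrict_restrict hS, inter_compl_self,
      Measure.restrict_empty, add_zero]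
    exact Measure.restrict_le_self
  · have h2 : (chartVol g e).restrict e.source = chartVol g e := by
      refine Measure.restrict_eq_self_of_ae_mem ?_
      rw [ae_iff]
      change chartVol g e e.sourceᶜ = 0
      rw [chartVol_apply g hS.compl]
      have h3 : e.symm ⁻¹' e.sourceᶜ ∩ e.target = ∅ :=
        eq_empty_of_forall_notMem fun y hy => hy.1 (e.map_target hy.2)
      rw [h3]
      simp
    rw [← h2]
    exact Measure.restrict_mono subset_rfl (le_iSup (fun e' : smoothCharts n M =>
      chartVol g (e' : OpenPartialHomeomorph M (Eu n))) ⟨e, he⟩)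

/-- The integral over a coordinate domain, in coordinates. -/
theorem setIntegral_vol (g : RiemMetric n M) (he : e ∈ smoothCharts n M) (F : M → ℝ) :
    ∫ x in e.source, F x ∂(vol g) =
      ∫ y in e.target, density (metForm g e) y * F (e.symm y) := by
  rw [vol_restrict g he, chartVol_eq, integral_map_symm e (coordVol_restrict g), coordVol,
    integral_withDensity_eq_integral_toReal_smul₀ (aemeasurable_ofReal_density g he)
      (by simp)]
  refine setIntegral_congr_fun e.open_target.measurableSet fun y hy => ?_
  simp [ENNReal.toReal_ofReal (density_metForm_pos g he hy).le]

theorem integrableOn_source_vol_iff (g : RiemMetric n M) (he : e ∈ smoothCharts n M) (F : M → ℝ) :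
    IntegrableOn F e.source (vol g) ↔
      IntegrableOn (fun y => density (metForm g e) y * F (e.symm y)) e.target := by
  rw [IntegrableOn, vol_restrict g he, chartVol_eq, integrable_map_symm e (coordVol_restrict g),
    coordVol, integrable_withDensity_iff_integrable_smul₀' (aemeasurable_ofReal_density g he)
      (by simp)]
  refine integrableOn_congr_fun (fun y hy => ?_) e.open_target.measurableSet
  simp [ENNReal.toReal_ofReal (density_metForm_pos g he hy).le]

theorem locallyIntegrableOn_comp_symm (g : RiemMetric n M) (he : e ∈ smoothCharts n M)
    {u : M → ℝ} (hu : LocallyIntegrable u (vol g)) :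
    LocallyIntegrableOn (fun y => u (e.symm y)) e.target := by
  have h1 : LocallyIntegrableOn (fun y => density (metForm g e) y * u (e.symm y)) e.target := by
    intro y hy
    obtain ⟨U, hU, hUi⟩ := hu (e.symm y)
    obtain ⟨V, hVU, hVo, hyV⟩ := mem_nhds_iff.1 hU
    -- Cutting off by an indicator gives a function integrable on the whole chart domain, to which
    -- the transfer to coordinates applies.
    have h2 : IntegrableOn (V.indicator u) e.source (vol g) :=
      ((hUi.mono_set hVU).integrable_indicator hVo.measurableSet).integrableOn
    rw [integrableOn_source_vol_iff g he] at h2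
    refine ⟨e.symm ⁻¹' V ∩ e.target, Filter.inter_mem ?_ self_mem_nhdsWithin, ?_⟩
    · exact mem_nhdsWithin_of_mem_nhds
        ((e.continuousAt_symm hy).preimage_mem_nhds (hVo.mem_nhds hyV))
    · refine (h2.mono_set inter_subset_right).congr_fun (fun z hz => ?_)
        (measurableSet_symm_preimage_inter e hVo.measurableSet)
      simp only [indicator_of_mem (show e.symm z ∈ V from hz.1)]
  -- The density is positive and continuous, hence can be divided out locally.
  have h3 : ContinuousOn (fun y => (density (metForm g e) y)⁻¹) e.target :=
    (contDiffOn_density g he).continuousOn.inv₀ fun y hy => (density_metForm_pos g he hy).ne'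
  have h4 := h1.continuousOn_mul h3 e.open_target.isLocallyClosed
  refine h4.congr (ae_restrict_of_forall_mem e.open_target.measurableSet fun y hy => ?_)
  exact inv_mul_cancel_left₀ (density_metForm_pos g he hy).ne' _

end Volume

/-! ### Calculus of Euclidean weak derivatives -/

section WeakPartial

variable {n : ℕ} {D : Set (Eu n)}

theorem partialD_mul {f h : Eu n → ℝ} {y : Eu n} (hf : DifferentiableAt ℝ f y)
    (hh : DifferentiableAt ℝ h y) (a : Fin n) :
    partialD a (fun z => f z * h z) y = f y * partialD a h y + partialD a f y * h y := by
  rw [partialD, (hf.hasFDerivAt.fun_mul hh.hasFDerivAt).fderiv]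
  simp [partialD, mul_comm]

theorem contDiff_partialD {ψ : Eu n → ℝ} (hψ : ContDiff ℝ ∞ ψ) (a : Fin n) :
    ContDiff ℝ ∞ (partialD a ψ) :=
  (hψ.fderiv_right (m := ∞) (by simp)).clm_apply contDiff_const

theorem contDiffOn_partialD {c : Eu n → ℝ} (hD : IsOpen D) (hc : ContDiffOn ℝ ∞ c D) (a : Fin n) :
    ContDiffOn ℝ ∞ (partialD a c) D :=
  (hc.fderiv_of_isOpen hD (m := ∞) (by simp)).clm_apply contDiffOn_const

theorem tsupport_partialD_subset (ψ : Eu n → ℝ) (a : Fin n) :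
    tsupport (partialD a ψ) ⊆ tsupport ψ :=
  tsupport_fderiv_apply_subset ℝ (stdVec a)

theorem iterPartialD_one (ψ : Eu n → ℝ) (a : Fin n) (y : Eu n) :
    iterPartialD (fun _ : Fin 1 => a) ψ y = partialD a ψ y := by
  simp [iterPartialD, partialD]

theorem iterPartialD_cons {k : ℕ} {ψ : Eu n → ℝ} (hψ : ContDiff ℝ ∞ ψ) (a : Fin n)
    (I : Fin k → Fin n) (y : Eu n) :
    iterPartialD (Fin.cons (α := fun _ => Fin n) a I) ψ y = partialD a (iterPartialD I ψ) y := by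
  have h1 : DifferentiableAt ℝ (iteratedFDeriv ℝ k ψ) y :=
    (hψ.differentiable_iteratedFDeriv (by exact_mod_cast WithTop.coe_lt_top k)) y
  have h2 : HasFDerivAt (fun z => iteratedFDeriv ℝ k ψ z fun j => stdVec (I j))
      ((ContinuousMultilinearMap.apply ℝ (fun _ : Fin k => Eu n) ℝ fun j => stdVec (I j)).comp
        (fderiv ℝ (iteratedFDeriv ℝ k ψ) y)) y :=
    (ContinuousMultilinearMap.apply ℝ (fun _ : Fin k => Eu n) ℝ
      fun j => stdVec (I j)).hasFDerivAt.comp y h1.hasFDerivAt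
  rw [iterPartialD, iteratedFDeriv_succ_apply_left]
  refine Eq.trans ?_ (congrArg (fun L => L (stdVec a)) h2.fderiv).symm
  rfl

theorem contDiff_iterPartialD {k : ℕ} {ψ : Eu n → ℝ} (hψ : ContDiff ℝ ∞ ψ) (I : Fin k → Fin n) :
    ContDiff ℝ ∞ (iterPartialD I ψ) := by
  have h := hψ.iteratedFDeriv_right (m := ∞) (i := k) (by exact_mod_cast le_top)
  exact (ContinuousMultilinearMap.apply ℝ (fun _ : Fin k => Eu n) ℝ
    fun j => stdVec (I j)).contDiff.comp h

theorem tsupport_iterPartialD_subset {k : ℕ} (ψ : Eu n → ℝ) (I : Fin k → Fin n) :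
    tsupport (iterPartialD I ψ) ⊆ tsupport ψ := by
  refine (closure_mono fun y hy => ?_).trans (tsupport_iteratedFDeriv_subset (𝕜 := ℝ) k)
  intro h
  exact hy (by simp [iterPartialD, h])

theorem integrableOn_mul_of_tsupport_subset {f ψ : Eu n → ℝ} (hf : LocallyIntegrableOn f D)
    (hψ : Continuous ψ) (hψc : HasCompactSupport ψ) (hψt : tsupport ψ ⊆ D) :
    IntegrableOn (fun y => f y * ψ y) D := by
  have h1 : IntegrableOn (fun y => f y * ψ y) (tsupport ψ) :=
    (hf.integrableOn_compact_subset hψt hψc).mul_continuousOn hψ.continuousOn hψc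
  refine Integrable.integrableOn ((integrableOn_iff_integrable_of_support_subset ?_).1 h1)
  exact fun y hy => subset_tsupport ψ fun h => hy (by simp [h])

theorem isWeakPartial_zero {f : Eu n → ℝ} (hf : LocallyIntegrableOn f D)
    (I : Fin 0 → Fin n) : IsWeakPartial D f I f :=
  ⟨hf, hf, fun ψ _ _ _ => by simp [iterPartialD]⟩

/-- The first-order identity for `f` is tested with ∂_I ψ, which is again a test function; the signs
multiply. -/
theorem IsWeakPartial.cons {k : ℕ} {f w v : Eu n → ℝ} {a : Fin n} {I : Fin k → Fin n}
    (h1 : IsWeakPartial D f (fun _ : Fin 1 => a) w) (h2 : IsWeakPartial D w I v) :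
    IsWeakPartial D f (Fin.cons (α := fun _ => Fin n) a I) v := by
  refine ⟨h1.1, h2.2.1, fun ψ hψ hψc hψt => ?_⟩
  rw [h2.2.2 ψ hψ hψc hψt, h1.2.2 _ (contDiff_iterPartialD hψ I)
    (hψc.mono' ((subset_tsupport _).trans (tsupport_iterPartialD_subset ψ I)))
    ((tsupport_iterPartialD_subset ψ I).trans hψt)]
  simp only [iterPartialD_one, iterPartialD_cons hψ, pow_succ, pow_zero]
  ring

theorem IsWeakPartial.add {k : ℕ} {f f' v v' : Eu n → ℝ} {I : Fin k → Fin n}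
    (h : IsWeakPartial D f I v) (h' : IsWeakPartial D f' I v') :
    IsWeakPartial D (f + f') I (v + v') := by
  refine ⟨h.1.add h'.1, h.2.1.add h'.2.1, fun ψ hψ hψc hψt => ?_⟩
  have hI := contDiff_iterPartialD hψ I
  have hIc : HasCompactSupport (iterPartialD I ψ) :=
    hψc.mono' ((subset_tsupport _).trans (tsupport_iterPartialD_subset ψ I))
  have hIt := (tsupport_iterPartialD_subset ψ I).trans hψt
  simp only [Pi.add_apply, add_mul]
  rw [integral_add (integrableOn_mul_of_tsupport_subset h.2.1 hψ.continuous hψc hψt)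
      (integrableOn_mul_of_tsupport_subset h'.2.1 hψ.continuous hψc hψt),
    integral_add (integrableOn_mul_of_tsupport_subset h.1 hI.continuous hIc hIt)
      (integrableOn_mul_of_tsupport_subset h'.1 hI.continuous hIc hIt),
    h.2.2 ψ hψ hψc hψt, h'.2.2 ψ hψ hψc hψt, mul_add]

/-- The Leibniz rule. -/
theorem IsWeakPartial.mul_left (hD : IsOpen D) {f w c : Eu n → ℝ} {a : Fin n}
    (h : IsWeakPartial D f (fun _ : Fin 1 => a) w) (hc : ContDiffOn ℝ ∞ c D) :
    IsWeakPartial D (fun y => c y * f y) (fun _ : Fin 1 => a)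
      ((fun y => c y * w y) + fun y => partialD a c y * f y) := by
  have hDc := hD.isLocallyClosed
  have hpc := contDiffOn_partialD hD hc a
  have hf' := h.1.continuousOn_mul hpc.continuousOn hDc
  refine ⟨h.1.continuousOn_mul hc.continuousOn hDc,
    (h.2.1.continuousOn_mul hc.continuousOn hDc).add hf', fun ψ hψ hψc hψt => ?_⟩
  have hcψ := contDiff_mul_of_tsupport_subset hD hψ hψt hc
  have hcψc : HasCompactSupport fun y => ψ y * c y := hψc.mul_right
  have hcψt : tsupport (fun y => ψ y * c y) ⊆ D := (tsupport_mul_subset_left).trans hψt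
  -- The product of `ψ` and the coefficient is a test function for the undifferentiated identity;
  -- its classical product rule produces the extra term.
  have h1 := h.2.2 _ hcψ hcψc hcψt
  have i1 := integrableOn_mul_of_tsupport_subset h.2.1 hcψ.continuous hcψc hcψt
  have i2 := integrableOn_mul_of_tsupport_subset h.1 (contDiff_partialD hcψ a).continuous
    (hcψc.mono' ((subset_tsupport _).trans (tsupport_partialD_subset _ a)))
    ((tsupport_partialD_subset _ a).trans hcψt)
  have i3 := integrableOn_mul_of_tsupport_subset hf' hψ.continuous hψc hψt
  simp only [iterPartialD_one] at h1 ⊢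
  calc ∫ y in D, ((fun y => c y * w y) + fun y => partialD a c y * f y) y * ψ y
      = ∫ y in D, (w y * (ψ y * c y) + partialD a c y * f y * ψ y) :=
        integral_congr_ae (.of_forall fun y => by simp only [Pi.add_apply]; ring)
    _ = (-1) ^ 1 * ∫ y in D, (f y * partialD a (fun z => ψ z * c z) y -
          partialD a c y * f y * ψ y) := by
        rw [integral_add i1 i3, integral_sub i2 i3, h1]
        ring
    _ = _ := by
        congr 1
        refine setIntegral_congr_fun hD.measurableSet fun y hy => ?_
        simp only [partialD_mul (hψ.contDiffAt.differentiableAt (by simp))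
          ((hc.contDiffAt (hD.mem_nhds hy)).differentiableAt (by simp))]
        ring

/-- The function `f` has weak derivatives up to the order `j` on `D`. -/
def HasWeakPartials (D : Set (Eu n)) : ℕ → (Eu n → ℝ) → Prop
  | 0, f => LocallyIntegrableOn f D
  | j + 1, f => LocallyIntegrableOn f D ∧
      ∀ a, ∃ w, IsWeakPartial D f (fun _ : Fin 1 => a) w ∧ HasWeakPartials D j w

theorem HasWeakPartials.locallyIntegrableOn {f : Eu n → ℝ} :
    ∀ {j : ℕ}, HasWeakPartials D j f → LocallyIntegrableOn f D
  | 0, h => h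
  | _ + 1, h => h.1

theorem HasWeakPartials.of_succ {j : ℕ} {f : Eu n → ℝ} (h : HasWeakPartials D (j + 1) f) :
    HasWeakPartials D j f := by
  induction j generalizing f with
  | zero => exact h.1
  | succ j ih =>
    refine ⟨h.1, fun a => ?_⟩
    obtain ⟨w, hw, hw'⟩ := h.2 a
    exact ⟨w, hw, ih hw'⟩

theorem HasWeakPartials.add {j : ℕ} {f f' : Eu n → ℝ} (h : HasWeakPartials D j f)
    (h' : HasWeakPartials D j f') : HasWeakPartials D j (f + f') := by
  induction j generalizing f f' with
  | zero => exact LocallyIntegrableOn.add h h'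
  | succ j ih =>
    refine ⟨h.1.add h'.1, fun a => ?_⟩
    obtain ⟨w, hw, hw'⟩ := h.2 a
    obtain ⟨v, hv, hv'⟩ := h'.2 a
    exact ⟨w + v, hw.add hv, ih hw' hv'⟩

/-- The Leibniz rule leaves c·w and ∂c·f, both with `j` derivatives left: the first by the
hypothesis on w, the second because f loses one order. -/
theorem HasWeakPartials.mul_left (hD : IsOpen D) {j : ℕ} {f c : Eu n → ℝ}
    (h : HasWeakPartials D j f) (hc : ContDiffOn ℝ ∞ c D) :
    HasWeakPartials D j fun y => c y * f y := by
  induction j generalizing f c with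
  | zero => exact h.locallyIntegrableOn.continuousOn_mul hc.continuousOn hD.isLocallyClosed
  | succ j ih =>
    refine ⟨h.1.continuousOn_mul hc.continuousOn hD.isLocallyClosed, fun a => ?_⟩
    obtain ⟨w, hw, hw'⟩ := h.2 a
    exact ⟨_, hw.mul_left hD hc, (ih hw' hc).add (ih h.of_succ (contDiffOn_partialD hD hc a))⟩

theorem hasWeakPartials_zero (D : Set (Eu n)) (j : ℕ) : HasWeakPartials D j 0 := by
  have h0 : LocallyIntegrableOn (0 : Eu n → ℝ) D := locallyIntegrableOn_zero
  induction j with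
  | zero => exact h0
  | succ j ih => exact ⟨h0, fun a => ⟨0, ⟨h0, h0, by simp⟩, ih⟩⟩

theorem HasWeakPartials.sum {ι : Type*} (s : Finset ι) {j : ℕ} {f : ι → Eu n → ℝ}
    (h : ∀ i ∈ s, HasWeakPartials D j (f i)) : HasWeakPartials D j fun y => ∑ i ∈ s, f i y := by
  have h1 : (fun y => ∑ i ∈ s, f i y) = ∑ i ∈ s, f i := by
    funext y
    simp
  rw [h1]
  exact Finset.sum_induction f _ (fun _ _ => HasWeakPartials.add) (hasWeakPartials_zero D j) h

theorem HasWeakPartials.exists_isWeakPartial {j : ℕ} {f : Eu n → ℝ} (h : HasWeakPartials D j f)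
    (I : Fin j → Fin n) : ∃ v, IsWeakPartial D f I v := by
  induction j generalizing f with
  | zero => exact ⟨f, isWeakPartial_zero h I⟩
  | succ j ih =>
    obtain ⟨w, hw, hw'⟩ := h.2 (I 0)
    obtain ⟨v, hv⟩ := ih hw' (Fin.tail I)
    exact ⟨v, Fin.cons_self_tail I ▸ hw.cons hv⟩

end WeakPartial

/-! ### Weak covariant derivatives in a chart -/

section Tensors

variable {n : ℕ} {M : Type*} [TopologicalSpace M] [ChartedSpace (Eu n) M] {k : ℕ}

theorem IsSmoothTensor.neg {S : TensorField n M k} (hS : IsSmoothTensor S) :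
    IsSmoothTensor (-S) := fun e he I => (hS e he I).neg

theorem isSmoothTensor_zero : IsSmoothTensor (0 : TensorField n M k) :=
  fun _ _ _ => contDiffOn_const

theorem IsSmoothTensor.add {S T : TensorField n M k} (hS : IsSmoothTensor S)
    (hT : IsSmoothTensor T) : IsSmoothTensor (S + T) :=
  fun e he I => (hS e he I).add (hT e he I)

theorem IsSmoothTensor.sum {ι : Type*} [Fintype ι] {S : ι → TensorField n M k}
    (hS : ∀ i, IsSmoothTensor (S i)) : IsSmoothTensor (∑ i, S i) :=
  Finset.sum_induction S _ (fun _ _ => IsSmoothTensor.add) isSmoothTensor_zero fun i _ => hS i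

theorem IsCompactlySupported.neg {S : TensorField n M k} (hS : IsCompactlySupported S) :
    IsCompactlySupported (-S) := by
  obtain ⟨K, hK, h⟩ := hS
  exact ⟨K, hK, fun x hx => by rw [Pi.neg_apply, h x hx, neg_zero]⟩

theorem IsCompactlySupported.add {S T : TensorField n M k} (hS : IsCompactlySupported S)
    (hT : IsCompactlySupported T) : IsCompactlySupported (S + T) := by
  obtain ⟨K, hK, h⟩ := hS
  obtain ⟨L, hL, h'⟩ := hT
  refine ⟨K ∪ L, hK.union hL, fun x hx => ?_⟩
  rw [Pi.add_apply, h x fun h => hx (.inl h), h' x fun h => hx (.inr h), add_zero]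

theorem isCompactlySupported_zero : IsCompactlySupported (0 : TensorField n M k) :=
  ⟨∅, isCompact_empty, fun _ _ => rfl⟩

theorem IsCompactlySupported.sum {ι : Type*} [Fintype ι] {S : ι → TensorField n M k}
    (hS : ∀ i, IsCompactlySupported (S i)) : IsCompactlySupported (∑ i, S i) :=
  Finset.sum_induction S _ (fun _ _ => IsCompactlySupported.add) isCompactlySupported_zero
    fun i _ => hS i

variable [IsManifold (𝓡 n) ∞ M]

/-- The scalar product with a tensor, at a point. -/
def tensorInnerHom (g : RiemMetric n M) (S : TensorField n M k) (x : M) :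
    TensorField n M k →+ ℝ where
  toFun T := tensorInner g S T x
  map_zero' := Finset.sum_eq_zero fun _ _ => Finset.sum_eq_zero fun _ _ => mul_zero _
  map_add' T T' := by
    have h (e : OpenPartialHomeomorph M (Eu n)) (J : Fin k → Fin n) (y : Eu n) :
        comp e (T + T') J y = comp e T J y + comp e T' J y := rfl
    simp only [tensorInner, h, mul_add, Finset.sum_add_distrib]

theorem tensorInnerHom_apply (g : RiemMetric n M) (S T : TensorField n M k) (x : M) :
    tensorInnerHom g S x T = tensorInner g S T x := rfl

theorem tensorInner_eq_zero (g : RiemMetric n M) (S : TensorField n M k) {T : TensorField n M k}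
    {x : M} (h : T x = 0) : tensorInner g S T x = 0 := by
  refine Finset.sum_eq_zero fun I _ => Finset.sum_eq_zero fun J _ => ?_
  rw [comp_apply_chart (mem_chart_source _ x) T, h]
  exact mul_zero _

theorem tensorInner_scalarField (g : RiemMetric n M) (u : M → ℝ) (T : TensorField n M 0) (x : M) :
    tensorInner g (scalarField u) T x = u x * T x Fin.elim0 := by
  simp only [tensorInner, Fintype.sum_unique, Finset.univ_eq_empty, Finset.prod_empty, one_mul,
    comp_apply_chart (mem_chart_source _ x)]
  congr 2
  exact Subsingleton.elim _ _

variable [MeasurableSpace M] [BorelSpace M]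

/-- A locally integrable function is its own weak covariant derivative of order zero. -/
theorem isWeakCovDeriv_scalarField (g : RiemMetric n M) {u : M → ℝ}
    (hu : LocallyIntegrable u (vol g)) : IsWeakCovDeriv g u (scalarField u) := by
  refine ⟨hu, fun e he I => locallyIntegrableOn_comp_symm g he hu, fun θ _ _ => ?_⟩
  simp only [tensorInner_scalarField]
  rfl

theorem integral_eq_of_eq_zero (g : RiemMetric n M) {e : OpenPartialHomeomorph M (Eu n)}
    (he : e ∈ smoothCharts n M) {F : M → ℝ} (hF : ∀ x ∉ e.source, F x = 0) :
    ∫ x, F x ∂(vol g) = ∫ y in e.target, density (metForm g e) y * F (e.symm y) := by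
  rw [← setIntegral_vol g he, setIntegral_eq_integral_of_forall_compl_eq_zero hF]

variable [T2Space M]

/-- In a chart, the components of successive weak covariant derivatives are related by the
classical formula for the covariant derivative. -/
theorem IsWeakCovDeriv.isWeakPartial_comp (g : RiemMetric n M)
    {e : OpenPartialHomeomorph M (Eu n)} (he : e ∈ smoothCharts n M) {u : M → ℝ}
    {τ : TensorField n M k} {τ' : TensorField n M (k + 1)} (hτ : IsWeakCovDeriv g u τ)
    (hτ' : IsWeakCovDeriv g u τ') (I : Fin k → Fin n) (a : Fin n) :
    IsWeakPartial e.target (comp e τ I) (fun _ : Fin 1 => a) fun y =>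
      comp e τ' (Fin.snoc (α := fun _ => Fin n) I a) y + christoffelSum g e τ a I y := by
  have hD := e.open_target
  have hΓ : LocallyIntegrableOn (christoffelSum g e τ a I) e.target := by
    have h (μ : Fin k) (l : Fin n) : LocallyIntegrableOn
        (fun y => christoffel g e a (I μ) l y * comp e τ (Function.update I μ l) y) e.target :=
      (hτ.2.1 e he _).continuousOn_mul (contDiffOn_christoffel g he _ _ _).continuousOn
        hD.isLocallyClosed
    -- Order zero is mere local integrability, so the sum rule for weak derivatives serves here.
    exact (HasWeakPartials.sum (j := 0) _ fun μ _ => HasWeakPartials.sum (j := 0) _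
      fun l _ => h μ l)
  refine ⟨hτ.2.1 e he I, (hτ'.2.1 e he _).add hΓ, fun ψ hψ hψc hψt => ?_⟩
  have hρ : ContDiffOn ℝ ∞ (fun z => (density (metForm g e) z)⁻¹) e.target :=
    (contDiffOn_density g he).inv fun _ hz => (density_metForm_pos g he hz).ne'
  set θ := dualField g e (Fin.snoc (α := fun _ => Fin n) I a)
    fun z => ψ z / density (metForm g e) z with hθ
  have hdual {j : ℕ} (J : Fin j → Fin n) {c f : Eu n → ℝ} (hc : ContDiff ℝ ∞ c)
      (hcs : tsupport c ⊆ tsupport ψ) (hf : ContDiffOn ℝ ∞ f e.target) :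
      IsSmoothTensor (dualField g e J fun z => c z * f z) ∧
        IsCompactlySupported (dualField g e J fun z => c z * f z) := by
    have h1 : HasCompactSupport fun z => c z * f z :=
      HasCompactSupport.mul_right (hψc.mono' ((subset_tsupport _).trans hcs))
    have h2 : tsupport (fun z => c z * f z) ⊆ e.target :=
      (tsupport_mul_subset_left).trans (hcs.trans hψt)
    exact ⟨isSmoothTensor_dualField g he J
      (contDiff_mul_of_tsupport_subset hD hc (hcs.trans hψt) hf) h1 h2,
      isCompactlySupported_dualField g J h1 h2⟩
  have hθ1 : IsSmoothTensor θ ∧ IsCompactlySupported θ := hdual _ hψ subset_rfl hρ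
  have hA := hdual I (contDiff_partialD hψ a) (tsupport_partialD_subset ψ a) hρ
  have hB (μ : Fin k) (l : Fin n) := hdual (Function.update I μ l) hψ subset_rfl
    (hρ.mul (contDiffOn_christoffel g he a (I μ) l))
  have hη := covAdjoint_dualField g he I a hψ hψc hψt
  have hη1 : IsSmoothTensor (covAdjoint g θ) ∧ IsCompactlySupported (covAdjoint g θ) := by
    rw [hθ, hη, sub_eq_add_neg]
    simp only [div_eq_mul_inv, mul_assoc]
    exact ⟨hA.1.neg.add (IsSmoothTensor.sum fun μ => IsSmoothTensor.sum fun l => (hB μ l).1).neg,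
      hA.2.neg.add (IsCompactlySupported.sum fun μ =>
        IsCompactlySupported.sum fun l => (hB μ l).2).neg⟩
  -- Both sides equal the integral of u (∇*)^{k+1}θ, the iterated adjoint being defined by applying
  -- ∇* first to θ.
  have h1 : ∫ x, tensorInner g τ' θ x ∂(vol g) =
      ∫ x, tensorInner g τ (covAdjoint g θ) x ∂(vol g) :=
    (hτ'.2.2 θ hθ1.1 hθ1.2).trans (hτ.2.2 _ hη1.1 hη1.2).symm
  have hl : ∫ x, tensorInner g τ' θ x ∂(vol g) =
      ∫ y in e.target, comp e τ' (Fin.snoc (α := fun _ => Fin n) I a) y * ψ y := by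
    rw [integral_eq_of_eq_zero g he fun x hx =>
      tensorInner_eq_zero g τ' (dualField_of_notMem g _ _ hx)]
    refine setIntegral_congr_fun hD.measurableSet fun y hy => ?_
    have h0 := (density_metForm_pos g he hy).ne'
    simp only [tensorInner_dualField g he (e.map_target hy), e.right_inv hy]
    field_simp
  have hr : ∫ x, tensorInner g τ (covAdjoint g θ) x ∂(vol g) =
      ∫ y in e.target, (-(comp e τ I y * partialD a ψ y) - christoffelSum g e τ a I y * ψ y) := by
    rw [integral_eq_of_eq_zero g he fun x hx => tensorInner_eq_zero g τ (by
      rw [hθ, hη]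
      simp only [Pi.sub_apply, Pi.neg_apply, Finset.sum_apply, dualField_of_notMem g _ _ hx]
      simp)]
    refine setIntegral_congr_fun hD.measurableSet fun y hy => ?_
    have h0 := (density_metForm_pos g he hy).ne'
    simp only [hθ, hη]
    -- Additivity in the second argument splits the pairing with ∇*θ into pairings with single dual
    -- fields.
    simp only [← tensorInnerHom_apply, map_sub, map_neg, map_sum]
    simp only [tensorInnerHom_apply, tensorInner_dualField g he (e.map_target hy),
      e.right_inv hy, christoffelSum, Finset.sum_mul, mul_sub, Finset.mul_sum]
    congr 1
    · field_simp
    · refine Finset.sum_congr rfl fun μ _ => Finset.sum_congr rfl fun l _ => ?_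
      field_simp
  have i1 := integrableOn_mul_of_tsupport_subset (hτ'.2.1 e he
    (Fin.snoc (α := fun _ => Fin n) I a)) hψ.continuous hψc hψt
  have i2 := integrableOn_mul_of_tsupport_subset hΓ hψ.continuous hψc hψt
  have i3 := integrableOn_mul_of_tsupport_subset (hτ.2.1 e he I)
    (contDiff_partialD hψ a).continuous
    (hψc.mono' ((subset_tsupport _).trans (tsupport_partialD_subset ψ a)))
    ((tsupport_partialD_subset ψ a).trans hψt)
  have i4 : IntegrableOn (fun y => -(comp e τ I y * partialD a ψ y)) e.target := i3.neg
  simp only [add_mul, iterPartialD_one]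
  rw [integral_add i1 i2, ← hl, h1, hr, integral_sub i4 i2]
  have h4 : ∫ y in e.target, -(comp e τ I y * partialD a ψ y) =
      -∫ y in e.target, comp e τ I y * partialD a ψ y := integral_neg _
  rw [h4]
  ring

/-- Induction on the number `j` of remaining derivatives, for all tensor orders at once: one
derivative either raises the tensor order or costs a smooth Christoffel factor, and `m + j ≤ N` is
preserved. -/
theorem hasWeakPartials_comp (g : RiemMetric n M) {e : OpenPartialHomeomorph M (Eu n)}
    (he : e ∈ smoothCharts n M) {u : M → ℝ} {τ : (m : ℕ) → TensorField n M m} {N : ℕ}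
    (hτ : ∀ m ≤ N, IsWeakCovDeriv g u (τ m)) (j m : ℕ) (hm : m + j ≤ N) (I : Fin m → Fin n) :
    HasWeakPartials e.target j (comp e (τ m) I) := by
  induction j generalizing m with
  | zero => exact (hτ m (by omega)).2.1 e he I
  | succ j ih =>
    refine ⟨(hτ m (by omega)).2.1 e he I, fun a => ⟨_, IsWeakCovDeriv.isWeakPartial_comp g he
      (hτ m (by omega)) (hτ (m + 1) (by omega)) I a, ?_⟩⟩
    refine (ih (m + 1) (by omega) _).add (HasWeakPartials.sum _ fun μ _ =>
      HasWeakPartials.sum _ fun l _ => ?_)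
    exact (ih m (by omega) _).mul_left e.open_target (contDiffOn_christoffel g he _ _ _)

end Tensors

end WeakCov

end

/-! ### The main theorem -/

open WeakCov in
theorem theorem1p1 {n : ℕ} {M : Type*} [TopologicalSpace M] [T2Space M]
    [SecondCountableTopology M] [MeasurableSpace M] [BorelSpace M]
    [ChartedSpace (Eu n) M] [IsManifold (𝓡 n) ∞ M] (g : RiemMetric n M)
    (k : ℕ) (hk : 1 ≤ k) (e : OpenPartialHomeomorph M (Eu n)) (he : e ∈ smoothCharts n M)
    (u : M → ℝ)
    (hu : ∀ m : ℕ, 1 ≤ m → m ≤ k → ∃ τ : TensorField n M m, IsWeakCovDeriv g u τ) :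
    (∀ m : ℕ, 1 ≤ m → m ≤ k → ∀ I : Fin m → Fin n,
      ∃ v : Eu n → ℝ, IsWeakPartial e.target (u ∘ e.symm) I v) ∧
    (∀ τ : (m : ℕ) → TensorField n M m, τ 0 = scalarField u →
      (∀ m : ℕ, 1 ≤ m → m ≤ k → IsWeakCovDeriv g u (τ m)) →
      ∀ m : ℕ, m + 1 ≤ k → ∀ (I : Fin m → Fin n) (a : Fin n),
        ∃ w : Eu n → ℝ,
          IsWeakPartial e.target (comp e (τ m) I) (fun _ : Fin 1 => a) w ∧
          ∀ᵐ y ∂(volume.restrict e.target),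
            comp e (τ (m + 1)) (Fin.snoc (α := fun _ => Fin n) I a) y =
              w y - christoffelSum g e (τ m) a I y) := by
  -- Local integrability of `u` comes from the order-one hypothesis; it makes `u` its own derivative
  -- of order zero, the start of the induction.
  obtain ⟨τ₁, hτ₁⟩ := hu 1 le_rfl hk
  have h0 := isWeakCovDeriv_scalarField g hτ₁.1
  refine ⟨fun m _ hmk I => ?_, fun τ hτ0 hτ m hm I a => ?_⟩
  · have hex (j : ℕ) : ∃ σ : TensorField n M j, j ≤ k → IsWeakCovDeriv g u σ := by
      rcases Nat.eq_zero_or_pos j with rfl | hj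
      · exact ⟨scalarField u, fun _ => h0⟩
      · by_cases hjk : j ≤ k
        · obtain ⟨σ, hσ⟩ := hu j hj hjk
          exact ⟨σ, fun _ => hσ⟩
        · exact ⟨0, fun h => absurd h hjk⟩
    choose σ hσ using hex
    -- Order zero is reset to `u` itself, so that its component is `u ∘ e.symm` by definition.
    let τ : (j : ℕ) → TensorField n M j
      | 0 => scalarField u
      | j + 1 => σ (j + 1)
    have hτ (j : ℕ) (hj : j ≤ k) : IsWeakCovDeriv g u (τ j) := by
      cases j with
      | zero => exact h0
      | succ j => exact hσ (j + 1) hj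
    exact (hasWeakPartials_comp g he hτ m 0 (by omega) Fin.elim0).exists_isWeakPartial I
  · have hτm (j : ℕ) (hj : j ≤ k) : IsWeakCovDeriv g u (τ j) := by
      rcases Nat.eq_zero_or_pos j with rfl | h
      · rw [hτ0]
        exact h0
      · exact hτ j h hj
    -- The weak derivative provided is the next component plus the Christoffel sum, so the formula
    -- holds everywhere for this representative.
    refine ⟨_, (hτm m (by omega)).isWeakPartial_comp g he (hτm (m + 1) hm) I a,
      .of_forall fun y => ?_⟩
    simp only [add_sub_cancel_right]
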